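/- Let $\triangle\subset\mathbb C$ be the open unit disk and $\mathbb B^2\subset\mathbb C^2$ the open unit ball. For a complex manifold $X$, a point $x\in X$ and a tangent vector $v\in T_xX$ put $$\omega^X_K(x,v)=\inf\Big\{\tfrac1\lambda:\ \lambda>0,\ f:\triangle\to X\text{ holomorphic},\ f(0)=x,\ df(0)(1)=\lambda v\Big\},$$ and let $\omega^X_\iota(x,v)$ be the infimum of the same numbers $1/\lambda$ taken only over the injective holomorphic maps $f:\triangle\to X$. A subgroup $\Gamma$ of the group $\mathrm{Aut_{hol}}(\mathbb B^2)$ of holomorphic automorphisms of $\mathbb B^2$ is called Kleinian if every $z\in\mathbb B^2$ has an open neighbourhood $U$ such that $\phi\in\Gamma$ and $\phi(U)\cap U\neq\emptyset$ imply $\phi=\mathrm{id}$; then $X=\mathbb B^2/\Gamma$ is a complex manifold. An element $\phi\in\mathrm{Aut_{hol}}(\mathbb B^2)$ is called hyperbolic if its continuous extension to $\overline{\mathbb B^2}$ has precisely two distinct fixed points on $\overline{\mathbb B^2}$, both contained in the boundary $b\mathbb B^2$. **Theorem.** Let $\Gamma\subset\mathrm{Aut_{hol}}(\mathbb B^2)$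 be a Kleinian group, set $X:=\mathbb B^2/\Gamma$, and assume that $\Gamma$ contains at least one hyperbolic element. Then $\omega^X_K\neq\omega^X_\iota$, that is, there are $x\in X$ and $v\in T_xX$ with $\omega^X_K(x,v)\neq\omega^X_\iota(x,v)$. -/

import Mathlib

open Set Metric Topology
open scoped Manifold ContDiff ENNReal

/-! ### The (injective) Kobayashi metric of a complex manifold -/

section Metrics

variable (E : Type*) [NormedAddCommGroup E] [NormedSpace ℂ E]
  (X : Type*) [TopologicalSpace X] [ChartedSpace E X]

/-- `IsHolDisk E X f` : the restriction of `f` to the open unit disk is a holomorphic map from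
the unit disk to the complex manifold `X` (modelled on `E`). Values of `f` outside the disk are
irrelevant. -/
def IsHolDisk (f : ℂ → X) : Prop :=
  MDifferentiableOn 𝓘(ℂ, ℂ) 𝓘(ℂ, E) f (ball (0 : ℂ) 1)

variable [IsManifold 𝓘(ℂ, E) ω X]

/-- The infinitesimal Kobayashi metric at a tangent vector `p = (x, v)`: the infimum of the numbers
`1 / c`, `c > 0`, such that some holomorphic `f` from the unit disk to `X` has
`f 0 = x` and `df(0)(1) = c v`. -/
noncomputable def kobayashiMetric (p : TangentBundle 𝓘(ℂ, E) X) : ℝ≥0∞ :=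
  sInf {t : ℝ≥0∞ | ∃ c : ℝ, 0 < c ∧ t = ENNReal.ofReal (1 / c) ∧
    ∃ f : ℂ → X, IsHolDisk E X f ∧
      tangentMap 𝓘(ℂ, ℂ) 𝓘(ℂ, E) f ⟨0, (1 : ℂ)⟩ = ⟨p.proj, (c : ℂ) • p.snd⟩}

/-- The injective Kobayashi metric (Hahn metric): the same infimum, taken over the injective
holomorphic maps from the unit disk to `X` only. -/
noncomputable def injKobayashiMetric (p : TangentBundle 𝓘(ℂ, E) X) : ℝ≥0∞ :=
  sInf {t : ℝ≥0∞ | ∃ c : ℝ, 0 < c ∧ t = ENNReal.ofReal (1 / c) ∧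
    ∃ f : ℂ → X, IsHolDisk E X f ∧ InjOn f (ball (0 : ℂ) 1) ∧
      tangentMap 𝓘(ℂ, ℂ) 𝓘(ℂ, E) f ⟨0, (1 : ℂ)⟩ = ⟨p.proj, (c : ℂ) • p.snd⟩}

end Metrics

/-! ### The unit ball of `ℂ²` and its holomorphic automorphisms -/

/-- `ℂ²` with its Hermitian norm. -/
abbrev C2 : Type := EuclideanSpace ℂ (Fin 2)

/-- The open unit ball `𝔹²` of `ℂ²`. -/
def ball2 : TopologicalSpace.Opens C2 := ⟨ball (0 : C2) 1, isOpen_ball⟩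

/-- The group of holomorphic automorphisms of `𝔹²`: the bijections of `𝔹²` that are holomorphic
(complex analytic) together with their inverses. -/
noncomputable def holAut : Subgroup (ball2 ≃ₜ ball2) where
  carrier := {φ | ContMDiff 𝓘(ℂ, C2) 𝓘(ℂ, C2) ω φ ∧ ContMDiff 𝓘(ℂ, C2) 𝓘(ℂ, C2) ω φ.symm}
  mul_mem' := fun {_ _} ha hb => ⟨ha.1.comp hb.1, hb.2.comp ha.2⟩
  one_mem' := ⟨contMDiff_id, contMDiff_id⟩
  inv_mem' := fun {_} ha => ⟨ha.2, ha.1⟩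

/-- Automorphisms of the ball act on the ball by evaluation. -/
noncomputable instance holAutAction : MulAction holAut ball2 where
  smul φ z := φ.1 z
  one_smul _ := rfl
  mul_smul _ _ _ := rfl

/-- A group of automorphisms of `𝔹²` is Kleinian if every point has an open neighbourhood `U`
such that `φ(U) ∩ U ≠ ∅` only for the identity `φ` of the group. -/
def IsKleinian (Γ : Subgroup holAut) : Prop :=
  ∀ z : ball2, ∃ U : Set ball2, IsOpen U ∧ z ∈ U ∧
    ∀ φ ∈ Γ, ((fun w => φ • w) '' U ∩ U).Nonempty → φ = 1

/-- An automorphism of `𝔹²` is hyperbolic if it has precisely two distinct fixed points on the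
closed ball, both of them on the boundary sphere. Here `F` is the continuous extension
of `φ` to the closed ball (which always exists and is unique). -/
def IsHyperbolic (φ : holAut) : Prop :=
  ∃ F : C2 → C2, ContinuousOn F (closedBall 0 1) ∧ (∀ z : ball2, F z = ((φ • z : ball2) : C2)) ∧
    ∃ p q : C2, p ≠ q ∧ p ∈ sphere (0 : C2) 1 ∧ q ∈ sphere (0 : C2) 1 ∧
      {z ∈ closedBall (0 : C2) 1 | F z = z} = {p, q}

/-! ### The quotient manifold `𝔹²/Γ` -/

/-- The orbit space `𝔹²/Γ` of a Kleinian group `Γ`. -/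
def BallQuotient (Γ : Subgroup holAut) (_hΓ : IsKleinian Γ) : Type :=
  MulAction.orbitRel.Quotient Γ ball2

namespace BallQuotient

variable (Γ : Subgroup holAut) (hΓ : IsKleinian Γ)

/-- The quotient topology. -/
noncomputable instance instTop : TopologicalSpace (BallQuotient Γ hΓ) :=
  inferInstanceAs (TopologicalSpace (MulAction.orbitRel.Quotient Γ ball2))

/-- The quotient map `𝔹² → 𝔹²/Γ`. -/
noncomputable def proj : ball2 → BallQuotient Γ hΓ := Quotient.mk (MulAction.orbitRel Γ ball2)

/-- A choice of a representative of each orbit. -/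
noncomputable def out : BallQuotient Γ hΓ → ball2 :=
  Quotient.out (s := MulAction.orbitRel Γ ball2)

theorem isQuotientCoveringMap_proj : IsQuotientCoveringMap (proj Γ hΓ) Γ where
  toIsQuotientMap := isQuotientMap_quotient_mk'
  continuous_const_smul := fun γ => γ.1.1.continuous
  apply_eq_iff_mem_orbit := Quotient.eq''
  disjoint := fun z => by
    obtain ⟨U, hU, hz, h⟩ := hΓ z
    exact ⟨U, hU.mem_nhds hz, fun γ hγ => Subtype.ext (h γ.1 γ.2 hγ)⟩

theorem isLocalHomeomorph_proj : IsLocalHomeomorph (proj Γ hΓ) :=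
  (isQuotientCoveringMap_proj Γ hΓ).isCoveringMap.isLocalHomeomorph

/-- The charts of `𝔹²/Γ` are the local inverses of the quotient map, viewed as maps into `ℂ²`. -/
noncomputable instance instCharted : ChartedSpace C2 (BallQuotient Γ hΓ) :=
  (isLocalHomeomorph_proj Γ hΓ).chartedSpaceOfRightInverse
    (g := out Γ hΓ) Quotient.out_eq

/-- `𝔹²/Γ` is a complex manifold. -/
instance instManifold : IsManifold 𝓘(ℂ, C2) ω (BallQuotient Γ hΓ) := by
  have hf := isLocalHomeomorph_proj Γ hΓ
  have hcov := isQuotientCoveringMap_proj Γ hΓ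
  -- in the ball, the transition between two local inverses is locally an element of `Γ`
  have key : ∀ b u : ball2, proj Γ hΓ u ∈ (hf.localInverseAt b).source →
      ContMDiffAt 𝓘(ℂ, C2) 𝓘(ℂ, C2) ω (fun x => hf.localInverseAt b (proj Γ hΓ x)) u := by
    intro b u hu
    have hw := hf.apply_localInverseAt_of_mem hu
    obtain ⟨γ, hγ⟩ := hcov.apply_eq_iff_mem_orbit.mp hw
    have hcont : ContMDiff 𝓘(ℂ, C2) 𝓘(ℂ, C2) ω (fun x : ball2 => γ • x) := γ.1.2.1
    have hmem : γ • u ∈ (hf.localInverseAt b).target := by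
      change (fun m : Γ => m • u) γ ∈ _
      rw [hγ]
      exact (hf.localInverseAt b).map_source hu
    refine (hcont u).congr_of_eventuallyEq ?_
    filter_upwards [hcont.continuous.continuousAt.preimage_mem_nhds
      ((hf.localInverseAt b).open_target.mem_nhds hmem)] with x hx
    have h1 := (hf.localInverseAt b).right_inv hx
    rw [hf.localInverseAt_symm] at h1
    rw [← hcov.map_smul γ]
    exact h1
  apply isManifold_of_contDiffOn
  rintro e e' ⟨q, rfl⟩ ⟨q', rfl⟩
  generalize out Γ hΓ q = a
  generalize out Γ hΓ q' = b
  rw [← contMDiffOn_iff_contDiffOn]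
  rintro y ⟨hy, -⟩
  simp only [modelWithCornersSelf_coe_symm, preimage_id, OpenPartialHomeomorph.trans_source,
    OpenPartialHomeomorph.trans_symm_eq_symm_trans_symm, OpenPartialHomeomorph.coe_trans,
    OpenPartialHomeomorph.symm_source, mem_inter_iff, mem_preimage, Function.comp_apply,
    IsLocalHomeomorph.localInverseAt_symm] at hy
  obtain ⟨⟨hy1, hy2⟩, hy3, hy4⟩ := hy
  have c1 : ContMDiffAt 𝓘(ℂ, C2) 𝓘(ℂ, C2) ω (chartAt C2 a).symm y :=
    (contMDiffOn_chart_symm (I := 𝓘(ℂ, C2)) (n := ω) (x := a)).contMDiffAt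
      ((chartAt C2 a).open_target.mem_nhds hy1)
  have c2 := key b _ hy3
  have c3 : ContMDiffAt 𝓘(ℂ, C2) 𝓘(ℂ, C2) ω (chartAt C2 b)
      (hf.localInverseAt b (proj Γ hΓ ((chartAt C2 a).symm y))) :=
    (contMDiffOn_chart (I := 𝓘(ℂ, C2)) (n := ω) (x := b)).contMDiffAt
      ((chartAt C2 b).open_source.mem_nhds hy4)
  have c4 := (ContMDiffAt.comp (f := fun x => hf.localInverseAt b (proj Γ hΓ x))
    ((chartAt C2 a).symm y) c3 c2).comp y c1
  refine ContMDiffAt.contMDiffWithinAt ?_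
  convert! c4 using 1
  ext1 z
  simp [Function.comp_def, OpenPartialHomeomorph.trans_symm_eq_symm_trans_symm]

end BallQuotient

/-!
The proof exhibits a point of `𝔹²/Γ` and a tangent vector there at which the Kobayashi metric is at
most `1` and the injective one is larger than `1`.

Let `φ ∈ Γ` be hyperbolic. A complex geodesic disk of the ball (the intersection with a complex
line) that meets its image under `φ` transversally cannot be approximated by disks that embed into
`𝔹²/Γ`: the intersection persists for all nearby disks `F`, which gives `F s = φ (F t)` with
`s ≠ t`, because `φ` has no fixed point in the ball, and thus two points of the disk `F` with the
same image in the quotient. On the other hand, if the two metrics agreed at the tangent vector of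
the geodesic disk, then there would be embedded disks, lifted to the ball by the covering property,
with the same centre, the same tangent direction and almost the extremal derivative. By the
Schwarz–Pick lemma such disks converge locally uniformly to the geodesic disk
(`tendstoLocallyUniformlyOn_smul_of_deriv`), so that `TendstoLocallyUniformlyOn.eventually_exists_eq`
gives the contradiction.

It remains to find the geodesic disk. By Cartan's theorem, `φ` is the fractional linear map of a
linear isometry `M` of the Lorentz form on `ℂ² × ℂ` (`exists_isLorentz_of_ball_automorphism`). For
hyperbolic `φ` the map `M` has three distinct eigenvalues and therefore a cyclic vector `v` in the
negative cone (`IsLorentz.exists_cyclic_vector`). If `z` is the corresponding point of the ball, then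
`z`, `φ z` and `φ (φ z)` do not lie on a complex line; hence the line through `z` and `φ z` and its
image under `φ`, which is the line through `φ z` and `φ (φ z)`, cross transversally at `φ z`
(`IsLorentz.exists_transversal_disk`). An involution of the ball moves `z` to the origin, where the
disk becomes the flat disk `ζ ↦ ζ • u`.
-/

/-! ### The Lorentz form and projective maps of the ball -/

section Lorentz

open scoped ComplexConjugate

variable {E : Type*} [NormedAddCommGroup E] [InnerProductSpace ℂ E]

/-- The Lorentz form `⟨v, w⟩ - conj v₀ * w₀` on `E × ℂ`, conjugate linear in the first argument. -/
noncomputable def lorentz (v w : E × ℂ) : ℂ := inner ℂ v.1 w.1 - conj v.2 * w.2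

/-- A linear self-map of `E × ℂ` is a Lorentz isometry if it preserves the Lorentz form. -/
def IsLorentz (M : E × ℂ →L[ℂ] E × ℂ) : Prop := ∀ v w, lorentz (M v) (M w) = lorentz v w

/-- The fractional linear map induced by a linear self-map of `E × ℂ` on the affine chart
`z ↦ [z : 1]` of the projective space of `E × ℂ`. -/
noncomputable def projAct (M : E × ℂ →L[ℂ] E × ℂ) (z : E) : E := (M (z, 1)).2⁻¹ • (M (z, 1)).1

theorem lorentz_add_right (u v w : E × ℂ) : lorentz u (v + w) = lorentz u v + lorentz u w := by
  simp only [lorentz, Prod.fst_add, Prod.snd_add, inner_add_right]; ring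

theorem lorentz_smul_right (u v : E × ℂ) (a : ℂ) : lorentz u (a • v) = a * lorentz u v := by
  simp only [lorentz, Prod.smul_fst, Prod.smul_snd, inner_smul_right, smul_eq_mul]; ring

theorem lorentz_add_left (u v w : E × ℂ) : lorentz (u + v) w = lorentz u w + lorentz v w := by
  simp only [lorentz, Prod.fst_add, Prod.snd_add, inner_add_left, map_add]; ring

theorem lorentz_smul_left (u v : E × ℂ) (a : ℂ) : lorentz (a • u) v = conj a * lorentz u v := by
  simp only [lorentz, Prod.smul_fst, Prod.smul_snd, inner_smul_left, smul_eq_mul, map_mul]; ring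

theorem lorentz_conj_symm (u v : E × ℂ) : conj (lorentz u v) = lorentz v u := by
  simp only [lorentz, map_sub, inner_conj_symm, map_mul, Complex.conj_conj]; ring

theorem lorentz_self (v : E × ℂ) : lorentz v v = ((‖v.1‖ ^ 2 - ‖v.2‖ ^ 2 : ℝ) : ℂ) := by
  simp only [lorentz, inner_self_eq_norm_sq_to_K, Complex.conj_mul']
  push_cast; rfl

namespace IsLorentz

variable {M N : E × ℂ →L[ℂ] E × ℂ}

theorem comp (hM : IsLorentz M) (hN : IsLorentz N) : IsLorentz (M ∘L N) := fun v w => by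
  simp only [ContinuousLinearMap.comp_apply, hM _ _, hN _ _]

theorem injective (hM : IsLorentz M) : Function.Injective M := by
  rw [injective_iff_map_eq_zero]
  intro v hv
  have h : ∀ w, lorentz v w = 0 := fun w => by rw [← hM, hv]; simp [lorentz]
  have h1 := h (v.1, 0)
  have h2 := h (0, 1)
  simp [lorentz] at h1 h2
  exact Prod.ext h1 h2

theorem norm_sq_sub (hM : IsLorentz M) (v : E × ℂ) :
    ‖(M v).1‖ ^ 2 - ‖(M v).2‖ ^ 2 = ‖v.1‖ ^ 2 - ‖v.2‖ ^ 2 := by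
  have := hM v v
  rw [lorentz_self, lorentz_self] at this
  exact_mod_cast this

/-- The denominator of the fractional linear map does not vanish on the closed ball. -/
theorem snd_ne_zero (hM : IsLorentz M) {z : E} (hz : ‖z‖ ≤ 1) : (M (z, 1)).2 ≠ 0 := by
  intro h
  have h1 := hM.norm_sq_sub (z, 1)
  simp only [h, norm_zero, norm_one] at h1
  have h2 : ‖(M (z, 1)).1‖ = 0 := by nlinarith [norm_nonneg z, norm_nonneg (M (z, 1)).1]
  have h3 : M (z, 1) = M 0 := by
    rw [map_zero]; exact Prod.ext (norm_eq_zero.mp h2) h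
  have := hM.injective h3
  simp at this

theorem apply_eq (hM : IsLorentz M) {z : E} (hz : ‖z‖ ≤ 1) :
    M (z, 1) = (M (z, 1)).2 • (projAct M z, (1 : ℂ)) := by
  have := hM.snd_ne_zero hz
  ext <;> simp [projAct, this]

theorem norm_projAct_lt (hM : IsLorentz M) {z : E} (hz : ‖z‖ < 1) : ‖projAct M z‖ < 1 := by
  have h0 := norm_pos_iff.mpr (hM.snd_ne_zero hz.le)
  have h1 := hM.norm_sq_sub (z, 1)
  simp only [norm_one] at h1
  rw [projAct, norm_smul, norm_inv, inv_mul_lt_iff₀ h0, mul_one]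
  nlinarith [norm_nonneg z, norm_nonneg (M (z, 1)).1]

theorem projAct_comp (hM : IsLorentz M) (hN : IsLorentz N) {z : E} (hz : ‖z‖ < 1) :
    projAct (M ∘L N) z = projAct M (projAct N z) := by
  have h0 := hN.snd_ne_zero hz.le
  have h1 := hM.snd_ne_zero (hN.norm_projAct_lt hz).le
  rw [projAct, ContinuousLinearMap.comp_apply, hN.apply_eq hz.le, map_smul]
  simp only [Prod.smul_fst, Prod.smul_snd, smul_eq_mul, mul_inv, smul_smul, projAct]
  congr 1
  field_simp

theorem differentiableAt_projAct (hM : IsLorentz M) {z : E} (hz : ‖z‖ ≤ 1) :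
    DifferentiableAt ℂ (projAct M) z := by
  have h1 : DifferentiableAt ℂ (fun z : E => M (z, 1)) z := by fun_prop
  exact (h1.snd.inv (hM.snd_ne_zero hz)).smul h1.fst

end IsLorentz

theorem projAct_id (z : E) : projAct (ContinuousLinearMap.id ℂ (E × ℂ)) z = z := by simp [projAct]

/-- The reflection in the orthogonal complement of `(z, 1 + √(1 - ‖z‖²))` exchanges the negative
lines through `(z, 1)` and `(0, 1)`: the ball is homogeneous under involutions. -/
theorem exists_isLorentz_projAct_eq_zero {z : E} (hz : ‖z‖ < 1) :
    ∃ R : E × ℂ →L[ℂ] E × ℂ, IsLorentz R ∧ R ∘L R = ContinuousLinearMap.id ℂ _ ∧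
      projAct R z = 0 ∧ projAct R 0 = z := by
  set κ : ℝ := √(1 - ‖z‖ ^ 2) with hκ
  have hpos : 0 < 1 - ‖z‖ ^ 2 := by nlinarith [norm_nonneg z]
  have hκ0 : 0 < κ := Real.sqrt_pos.mpr hpos
  have hκ2 : κ ^ 2 = 1 - ‖z‖ ^ 2 := Real.sq_sqrt hpos.le
  set u : E × ℂ := (z, ((1 + κ : ℝ) : ℂ)) with hu
  have huu : lorentz u u = ((-2 * κ * (1 + κ) : ℝ) : ℂ) := by
    rw [lorentz_self]
    simp only [hu, Complex.norm_real, Real.norm_eq_abs, sq_abs]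
    congr 1; nlinarith
  set q : ℂ := lorentz u u with hq
  have hqc : conj q = q := by rw [huu, Complex.conj_ofReal]
  have hq0 : q ≠ 0 := by
    rw [huu]
    have : 0 < κ * (1 + κ) := by positivity
    exact_mod_cast (by nlinarith : -2 * κ * (1 + κ) ≠ 0)
  let ℓ : E × ℂ →L[ℂ] ℂ := (innerSL ℂ z) ∘L ContinuousLinearMap.fst ℂ E ℂ -
    ((1 + κ : ℝ) : ℂ) • ContinuousLinearMap.snd ℂ E ℂ
  have hℓ : ∀ w, ℓ w = lorentz u w := fun w => by
    simp only [ℓ, lorentz, hu, Complex.conj_ofReal]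
    simp
  let R : E × ℂ →L[ℂ] E × ℂ := ContinuousLinearMap.id ℂ _ - (2 * q⁻¹) • ℓ.smulRight u
  have hR : ∀ w, R w = w + (-(2 * q⁻¹ * lorentz u w)) • u := fun w => by
    change w - (2 * q⁻¹) • (ℓ w • u) = _
    rw [hℓ, smul_smul, neg_smul, sub_eq_add_neg]
  have hRu : ∀ w, lorentz u (R w) = - lorentz u w := fun w => by
    rw [hR, lorentz_add_right, lorentz_smul_right, ← hq]; field_simp; ring
  have hL : IsLorentz R := by
    intro v w
    rw [hR v, lorentz_add_left, lorentz_smul_left, hRu, hR w, lorentz_add_right,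
      lorentz_smul_right, ← lorentz_conj_symm u v]
    simp only [map_neg, map_mul, map_inv₀, hqc, map_ofNat]
    ring
  have hRR : R ∘L R = ContinuousLinearMap.id ℂ _ := by
    apply ContinuousLinearMap.ext
    intro w
    rw [ContinuousLinearMap.comp_apply, hR (R w), hRu, hR w, add_assoc, ← add_smul]
    simp
  have hRz : projAct R z = 0 := by
    have h1 : lorentz u (z, 1) = q / 2 := by
      rw [huu]
      simp only [lorentz, hu, inner_self_eq_norm_sq_to_K, Complex.conj_ofReal]
      have : (κ : ℂ) ^ 2 = 1 - (‖z‖ : ℂ) ^ 2 := by exact_mod_cast hκ2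
      push_cast
      simp only [Complex.coe_algebraMap]
      linear_combination this
    have : (R (z, 1)).1 = 0 := by
      rw [hR, h1, show -(2 * q⁻¹ * (q / 2)) = -1 by field_simp]
      simp [hu]
    rw [projAct, this, smul_zero]
  refine ⟨R, hL, hRR, hRz, ?_⟩
  rw [← hRz, ← hL.projAct_comp hL hz, hRR, projAct_id]

end Lorentz

/-! ### Cartan's theorem and the automorphisms of the ball -/

section Cartan

variable {E : Type*} [NormedAddCommGroup E] [InnerProductSpace ℂ E]

/-- A biholomorphic self-map of the unit ball of a Hilbert space fixing the origin is the
restriction of a linear isometry: by the Schwarz lemma it preserves the norm, and the equality case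
applies on each complex line through the origin. -/
theorem exists_linearIsometry_of_ball_automorphism {f g : E → E}
    (hf : DifferentiableOn ℂ f (ball 0 1)) (hg : DifferentiableOn ℂ g (ball 0 1))
    (hfm : MapsTo f (ball 0 1) (ball 0 1)) (hgm : MapsTo g (ball 0 1) (ball 0 1))
    (hgf : ∀ z ∈ ball (0 : E) 1, g (f z) = z) (hf0 : f 0 = 0) :
    ∃ U : E →ₗᵢ[ℂ] E, ∀ z ∈ ball (0 : E) 1, f z = U z := by
  have h0 : (0 : E) ∈ ball (0 : E) 1 := mem_ball_self one_pos
  have hg0 : g 0 = 0 := by have := hgf 0 h0; rwa [hf0] at this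
  have hnorm : ∀ z ∈ ball (0 : E) 1, ‖f z‖ = ‖z‖ := by
    intro z hz
    apply le_antisymm
    · exact Complex.norm_le_norm_of_mapsTo_ball hf (hfm.mono_right ball_subset_closedBall) hf0
        (by simpa using hz)
    · have := Complex.norm_le_norm_of_mapsTo_ball hg (hgm.mono_right ball_subset_closedBall) hg0
        (z := f z) (by simpa using hfm hz)
      rwa [hgf z hz] at this
  have hlin : ∀ u : E, ‖u‖ = 1 → ∀ ζ ∈ ball (0 : ℂ) 1, f (ζ • u) = ζ • fderiv ℂ f 0 u := by
    intro u hu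
    have hmaps : MapsTo (fun ζ : ℂ => ζ • u) (ball 0 1) (ball 0 1) := fun ζ hζ => by
      simpa [norm_smul, hu] using hζ
    have hd : DifferentiableOn ℂ (fun ζ : ℂ => f (ζ • u)) (ball 0 1) :=
      hf.comp (by fun_prop) hmaps
    have hder : HasDerivAt (fun ζ : ℂ => f (ζ • u)) (fderiv ℂ f 0 u) 0 := by
      have h1 : HasFDerivAt f (fderiv ℂ f 0) ((0 : ℂ) • u) := by
        rw [zero_smul]; exact (hf.differentiableAt (ball_mem_nhds _ one_pos)).hasFDerivAt
      have h2 : HasDerivAt (fun ζ : ℂ => ζ • u) u 0 := by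
        simpa using (hasDerivAt_id (0 : ℂ)).smul_const u
      exact h1.comp_hasDerivAt (0 : ℂ) h2
    have : StrictConvexSpace ℝ E := by
      let := InnerProductSpace.rclikeToReal ℂ E
      infer_instance
    obtain ⟨C, -, hC⟩ := Complex.affine_of_mapsTo_ball_of_exists_norm_dslope_eq_div'
      (f := fun ζ : ℂ => f (ζ • u)) (c := 0) (R₁ := 1) (R₂ := 1) hd
      (fun ζ hζ => by
        simpa [hf0] using (ball_subset_closedBall (hfm (hmaps hζ)) : f (ζ • u) ∈ closedBall 0 1))
      ⟨1 / 2, by norm_num [mem_ball], by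
        rw [dslope_of_ne _ (by norm_num), slope_def_module, norm_smul]
        have : ‖f ((1 / 2 : ℂ) • u)‖ = 1 / 2 := by
          rw [hnorm _ (hmaps (by norm_num [mem_ball]))]; simp [norm_smul, hu]
        simp only [zero_smul, hf0, sub_zero, this]
        norm_num⟩
    have hCd : HasDerivAt (fun ζ : ℂ => f (ζ • u)) C 0 := by
      have h3 : HasDerivAt (fun ζ : ℂ => ζ • C) C 0 := by
        simpa using (hasDerivAt_id (0 : ℂ)).smul_const C
      refine h3.congr_of_eventuallyEq ?_
      filter_upwards [ball_mem_nhds (0 : ℂ) one_pos] with ζ hζ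
      simpa [hf0] using hC hζ
    intro ζ hζ
    rw [hder.unique hCd]
    simpa [hf0] using hC hζ
  have hball : ∀ z ∈ ball (0 : E) 1, f z = fderiv ℂ f 0 z := by
    intro z hz
    rcases eq_or_ne z 0 with rfl | hz0
    · simp [hf0]
    · have hn : (‖z‖ : ℂ) ≠ 0 := by simpa using hz0
      have := hlin ((‖z‖ : ℂ)⁻¹ • z) (by simp [norm_smul, hz0]) ‖z‖ (by simpa using hz)
      rwa [map_smul, smul_smul, smul_smul, mul_inv_cancel₀ hn, one_smul, one_smul] at this
  refine ⟨⟨(fderiv ℂ f 0).toLinearMap, fun z => ?_⟩, hball⟩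
  rcases eq_or_ne z 0 with rfl | hz0
  · simp
  have hn : (‖z‖ : ℂ) ≠ 0 := by simpa using hz0
  set c : ℂ := (2 * ‖z‖ : ℂ)⁻¹ with hc
  have hc0 : c ≠ 0 := by simp [hc, hz0]
  have hcz : c • z ∈ ball (0 : E) 1 := by
    rw [mem_ball_zero_iff, norm_smul, hc]
    simp only [norm_inv, norm_mul, Complex.norm_ofNat, Complex.norm_real, norm_norm]
    have := norm_pos_iff.mpr hz0
    field_simp; norm_num
  have h1 := hnorm _ hcz
  rw [hball _ hcz, map_smul, norm_smul, norm_smul] at h1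
  exact mul_left_cancel₀ (norm_ne_zero_iff.mpr hc0) h1

theorem isLorentz_prodMap_id (U : E →ₗᵢ[ℂ] E) :
    IsLorentz (U.toContinuousLinearMap.prodMap (ContinuousLinearMap.id ℂ ℂ)) := fun v w => by
  simp [lorentz]

/-- Every biholomorphic self-map of the unit ball is the fractional linear map of a Lorentz
isometry. -/
theorem exists_isLorentz_of_ball_automorphism {f g : E → E}
    (hf : DifferentiableOn ℂ f (ball 0 1)) (hg : DifferentiableOn ℂ g (ball 0 1))
    (hfm : MapsTo f (ball 0 1) (ball 0 1)) (hgm : MapsTo g (ball 0 1) (ball 0 1))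
    (hgf : ∀ z ∈ ball (0 : E) 1, g (f z) = z) :
    ∃ M : E × ℂ →L[ℂ] E × ℂ, IsLorentz M ∧ ∀ z ∈ ball (0 : E) 1, f z = projAct M z := by
  have hf0 := hfm (mem_ball_self one_pos)
  obtain ⟨R, hR, hRR, hRz, -⟩ := exists_isLorentz_projAct_eq_zero (mem_ball_zero_iff.mp hf0)
  have hRd : DifferentiableOn ℂ (projAct R) (ball 0 1) := fun z hz =>
    (hR.differentiableAt_projAct (mem_ball_zero_iff.mp hz).le).differentiableWithinAt
  have hRm : MapsTo (projAct R) (ball 0 1) (ball 0 1) := fun z hz =>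
    mem_ball_zero_iff.mpr (hR.norm_projAct_lt (mem_ball_zero_iff.mp hz))
  have hRinv : ∀ z ∈ ball (0 : E) 1, projAct R (projAct R z) = z := fun z hz => by
    rw [← hR.projAct_comp hR (mem_ball_zero_iff.mp hz), hRR, projAct_id]
  obtain ⟨U, hU⟩ := exists_linearIsometry_of_ball_automorphism (f := projAct R ∘ f)
    (g := g ∘ projAct R) (hRd.comp hf hfm) (hg.comp hRd hRm) (hRm.comp hfm) (hgm.comp hRm)
    (fun z hz => by simp only [Function.comp_apply]; rw [hRinv _ (hfm hz), hgf z hz])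
    (by simpa using hRz)
  have hUL := isLorentz_prodMap_id U
  refine ⟨R ∘L U.toContinuousLinearMap.prodMap (ContinuousLinearMap.id ℂ ℂ), hR.comp hUL, ?_⟩
  intro z hz
  rw [hR.projAct_comp hUL (mem_ball_zero_iff.mp hz)]
  have : projAct (U.toContinuousLinearMap.prodMap (ContinuousLinearMap.id ℂ ℂ)) z = U z := by
    simp [projAct]
  rw [this, ← hU z hz, Function.comp_apply, hRinv _ (hfm hz)]

end Cartan

/-! ### Almost extremal disks in the ball -/

section Disks

open Filter
open scoped ComplexConjugate

/-- A Schwarz–Pick estimate: a holomorphic function on the disk bounded by `1` whose value at the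
centre is close to `1` is close to `1` everywhere. -/
theorem norm_one_sub_le_of_norm_le_one {k : ℂ → ℂ} {c : ℝ} (hc0 : 0 ≤ c) (hc1 : c < 1)
    (hk : DifferentiableOn ℂ k (ball 0 1)) (hk1 : ∀ ζ ∈ ball (0 : ℂ) 1, ‖k ζ‖ ≤ 1)
    (hk0 : k 0 = c) {ζ : ℂ} (hζ : ‖ζ‖ < 1) : ‖1 - k ζ‖ ≤ 2 * (1 - c) / (1 - ‖ζ‖) := by
  have hden : ∀ w : ℂ, ‖w‖ ≤ 1 → 1 - c * w ≠ 0 := by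
    intro w hw h
    have h1 : (c * w : ℂ) = 1 := (sub_eq_zero.mp h).symm
    have h2 : c * ‖w‖ = 1 := by
      have := congrArg norm h1
      rwa [norm_mul, norm_one, Complex.norm_real, Real.norm_of_nonneg hc0] at this
    nlinarith [norm_nonneg w]
  have hmob : ∀ w : ℂ, ‖w‖ ≤ 1 → ‖w - c‖ ≤ ‖1 - c * w‖ := by
    intro w hw
    apply le_of_sq_le_sq _ (norm_nonneg _)
    have hw2 : Complex.normSq w ≤ 1 := by
      rw [Complex.normSq_eq_norm_sq]; nlinarith [norm_nonneg w]
    rw [← Complex.normSq_eq_norm_sq, ← Complex.normSq_eq_norm_sq]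
    rw [Complex.normSq_apply] at hw2
    simp only [Complex.normSq_apply, Complex.sub_re, Complex.sub_im, Complex.mul_re,
      Complex.mul_im, Complex.ofReal_re, Complex.ofReal_im, Complex.one_re, Complex.one_im]
    have : 0 ≤ (1 - c ^ 2) * (1 - (w.re * w.re + w.im * w.im)) :=
      mul_nonneg (by nlinarith) (by linarith)
    nlinarith
  -- the Schwarz lemma for `k` followed by the disk automorphism moving `c` to `0`
  have hm : ‖(k ζ - c) / (1 - c * k ζ)‖ ≤ ‖ζ‖ := by
    refine Complex.norm_le_norm_of_mapsTo_ball (f := fun ζ => (k ζ - c) / (1 - c * k ζ)) (R := 1)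
      ?_ ?_ ?_ hζ
    · exact (hk.sub_const _).div ((hk.const_mul _).const_sub _) fun z hz => hden _ (hk1 z hz)
    · intro z hz
      have h := hk1 z hz
      rw [mem_closedBall_zero_iff, norm_div]
      exact div_le_one_of_le₀ (hmob _ h) (norm_nonneg _)
    · simp [hk0]
  have hkζ := hk1 ζ (by simpa using hζ)
  rw [norm_div, div_le_iff₀ (norm_pos_iff.mpr (hden _ hkζ))] at hm
  have h1 : ‖1 - c * k ζ‖ ≤ (1 - c ^ 2) + c * ‖k ζ - c‖ := by
    calc ‖1 - c * k ζ‖ = ‖((1 - c ^ 2 : ℝ) : ℂ) - c * (k ζ - c)‖ := by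
          congr 1; push_cast; ring
      _ ≤ ‖((1 - c ^ 2 : ℝ) : ℂ)‖ + ‖(c : ℂ) * (k ζ - c)‖ := norm_sub_le _ _
      _ = _ := by
          rw [norm_mul, Complex.norm_real, Complex.norm_real, Real.norm_of_nonneg hc0,
            Real.norm_of_nonneg (by nlinarith)]
  have h2 : ‖1 - k ζ‖ ≤ (1 - c) + ‖k ζ - c‖ := by
    calc ‖1 - k ζ‖ = ‖((1 - c : ℝ) : ℂ) - (k ζ - c)‖ := by congr 1; push_cast; ring
      _ ≤ _ := (norm_sub_le _ _).trans_eq (by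
        rw [Complex.norm_real, Real.norm_of_nonneg (by linarith)])
  have hr := norm_nonneg ζ
  have hx := norm_nonneg (k ζ - c)
  have h3 : ‖k ζ - c‖ * (1 - ‖ζ‖) ≤ ‖ζ‖ * (2 * (1 - c)) := by
    have h4 := mul_le_mul_of_nonneg_left h1 hr
    have h5 : 0 ≤ ‖ζ‖ * ‖k ζ - c‖ * (1 - c) := by
      have := sub_pos.mpr hc1
      positivity
    have h6 : 0 ≤ ‖ζ‖ * (1 - c) ^ 2 := by positivity
    nlinarith
  rw [le_div_iff₀ (by linarith)]
  have h7 := mul_le_mul_of_nonneg_right h2 (sub_pos.mpr hζ).le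
  nlinarith [mul_nonneg hr (sub_pos.mpr hc1).le]

variable {E : Type*} [NormedAddCommGroup E] [InnerProductSpace ℂ E] [CompleteSpace E]

/-- A disk in the ball through the origin whose derivative there is almost the extremal one is
close to the flat disk `ζ ↦ ζ • u`. -/
theorem norm_sub_smul_sq_le {F : ℂ → E} {u : E} {c : ℝ} (hc0 : 0 ≤ c) (hc1 : c < 1)
    (hu : ‖u‖ = 1) (hF : DifferentiableOn ℂ F (ball 0 1)) (hFm : MapsTo F (ball 0 1) (ball 0 1))
    (hF0 : F 0 = 0) (hF' : deriv F 0 = (c : ℂ) • u) {ζ : ℂ} (hζ : ‖ζ‖ < 1) :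
    ‖F ζ - ζ • u‖ ^ 2 ≤ 4 * (1 - c) / (1 - ‖ζ‖) := by
  set K := dslope F 0 with hK
  have hKd : DifferentiableOn ℂ K (ball 0 1) :=
    (Complex.differentiableOn_dslope (ball_mem_nhds _ one_pos)).mpr hF
  have hK1 : ∀ z ∈ ball (0 : ℂ) 1, ‖K z‖ ≤ 1 := fun z hz => by
    simpa using Complex.norm_dslope_le_div_of_mapsTo_ball (R₂ := 1) hF
      (fun w hw => by simpa [hF0] using ball_subset_closedBall (hFm hw)) hz
  have hk := norm_one_sub_le_of_norm_le_one (k := fun z => inner ℂ u (K z)) hc0 hc1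
    ((innerSL ℂ u).differentiable.comp_differentiableOn hKd)
    (fun z hz => (norm_inner_le_norm _ _).trans (by rw [hu, one_mul]; exact hK1 z hz))
    (by simp [hK, hF', inner_self_eq_norm_sq_to_K, hu]) hζ
  have hKζ := hK1 ζ (by simpa using hζ)
  have hFK : F ζ - ζ • u = ζ • (K ζ - u) := by
    have := sub_smul_dslope F 0 ζ
    rw [smul_sub, hK]
    simpa [hF0] using this.symm
  have hre : (1 - inner ℂ u (K ζ) : ℂ).re ≤ 2 * (1 - c) / (1 - ‖ζ‖) :=
    (Complex.re_le_norm _).trans hk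
  have hKu : ‖K ζ - u‖ ^ 2 ≤ 2 * (2 * (1 - c) / (1 - ‖ζ‖)) := by
    have h1 := @norm_sub_sq ℂ E _ _ _ u (K ζ)
    rw [norm_sub_rev, h1, hu]
    simp only [Complex.sub_re, Complex.one_re] at hre
    have h2 : RCLike.re (inner ℂ u (K ζ)) = (inner ℂ u (K ζ)).re := rfl
    rw [h2]
    nlinarith [norm_nonneg (K ζ)]
  rw [hFK, norm_smul, mul_pow]
  calc ‖ζ‖ ^ 2 * ‖K ζ - u‖ ^ 2 ≤ 1 * ‖K ζ - u‖ ^ 2 := by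
        gcongr; nlinarith [norm_nonneg ζ]
    _ ≤ _ := by rw [one_mul]; exact hKu.trans_eq (by ring)

/-- Disks in the ball through the origin converge to the flat disk `ζ ↦ ζ • u` if their derivatives
at the centre converge to the extremal one. -/
theorem tendstoLocallyUniformlyOn_smul_of_deriv {F : ℝ → ℂ → E} {u : E} (hu : ‖u‖ = 1)
    (hF : ∀ c ∈ Ioo (0 : ℝ) 1, DifferentiableOn ℂ (F c) (ball 0 1))
    (hFm : ∀ c ∈ Ioo (0 : ℝ) 1, MapsTo (F c) (ball 0 1) (ball 0 1))
    (hF0 : ∀ c ∈ Ioo (0 : ℝ) 1, F c 0 = 0)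
    (hF' : ∀ c ∈ Ioo (0 : ℝ) 1, deriv (F c) 0 = (c : ℂ) • u) :
    TendstoLocallyUniformlyOn F (fun ζ => ζ • u) (𝓝[<] 1) (ball 0 1) := by
  rw [Metric.tendstoLocallyUniformlyOn_iff]
  intro ε hε x hx
  obtain ⟨r, hxr, hr⟩ := exists_between (mem_ball_zero_iff.mp hx)
  refine ⟨ball 0 r, mem_nhdsWithin_of_mem_nhds (isOpen_ball.mem_nhds (by simpa using hxr)), ?_⟩
  have hlim : Tendsto (fun c : ℝ => 4 * (1 - c) / (1 - r)) (𝓝[<] 1) (𝓝 0) := by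
    have : Continuous fun c : ℝ => 4 * (1 - c) / (1 - r) := by fun_prop
    simpa using (this.tendsto 1).mono_left nhdsWithin_le_nhds
  filter_upwards [hlim.eventually_lt_const (show 0 < ε ^ 2 by positivity),
    Ioo_mem_nhdsLT (show (0 : ℝ) < 1 by norm_num)] with c hc hc01 y hy
  have hy' : ‖y‖ < r := mem_ball_zero_iff.mp hy
  have h := norm_sub_smul_sq_le hc01.1.le hc01.2 hu (hF c hc01) (hFm c hc01) (hF0 c hc01)
    (hF' c hc01) (hy'.trans hr)
  rw [dist_comm, dist_eq_norm]
  apply lt_of_pow_lt_pow_left₀ 2 hε.le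
  refine h.trans_lt (lt_of_le_of_lt ?_ hc)
  have := hc01.2
  gcongr

end Disks

/-! ### Persistence of transversal intersections -/

section Persistence

open Filter

theorem TendstoLocallyUniformlyOn.continuous_comp {ι X Y Z : Type*} [TopologicalSpace X]
    [PseudoMetricSpace Y] [PseudoMetricSpace Z] {F : ι → X → Y} {f : X → Y} {p : Filter ι}
    {U : Set X} {g : Y → Z} (hF : TendstoLocallyUniformlyOn F f p U) (hf : ContinuousOn f U)
    (hg : ∀ x ∈ U, ContinuousAt g (f x)) :
    TendstoLocallyUniformlyOn (fun n => g ∘ F n) (g ∘ f) p U := by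
  rw [Metric.tendstoLocallyUniformlyOn_iff] at hF ⊢
  intro ε hε x hx
  obtain ⟨δ, hδ, h⟩ := Metric.continuousAt_iff.mp (hg x hx) (ε / 2) (half_pos hε)
  obtain ⟨t, ht, htF⟩ := hF (δ / 2) (half_pos hδ) x hx
  have hs : f ⁻¹' ball (f x) (δ / 2) ∈ 𝓝[U] x := hf x hx (ball_mem_nhds _ (half_pos hδ))
  refine ⟨t ∩ f ⁻¹' ball (f x) (δ / 2), inter_mem ht hs, ?_⟩
  filter_upwards [htF] with n hn y hy
  have h1 : dist (f y) (f x) < δ / 2 := hy.2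
  have h2 := hn y hy.1
  have h3 : dist (F n y) (f x) < δ := by
    linarith [dist_triangle_left (F n y) (f x) (f y)]
  have h4 := h (show dist (f y) (f x) < δ by linarith)
  have h5 := h h3
  simp only [Function.comp_apply]
  linarith [dist_triangle_right (g (f y)) (g (F n y)) (g (f x))]

variable {E : Type*} [NormedAddCommGroup E] [NormedSpace ℂ E] [CompleteSpace E]
  {ι : Type*} {p : Filter ι} [p.NeBot] {U : Set ℂ}

/-- A locally uniform limit of holomorphic curves is also a limit in the `C¹` topology: near `s₀`
the curves are uniformly close to being affine with the slope of the limit at `s₀`. -/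
theorem TendstoLocallyUniformlyOn.exists_norm_sub_sub_smul_deriv_le {a : ι → ℂ → E} {a₀ : ℂ → E}
    (ha : TendstoLocallyUniformlyOn a a₀ p U) (hU : IsOpen U)
    (had : ∀ᶠ n in p, DifferentiableOn ℂ (a n) U) {s₀ : ℂ} (hs₀ : s₀ ∈ U) {κ : ℝ} (hκ : 0 < κ) :
    ∃ ε > 0, closedBall s₀ ε ⊆ U ∧ ∀ᶠ n in p, ∀ s ∈ closedBall s₀ ε, ∀ s' ∈ closedBall s₀ ε,
      ‖a n s - a n s' - (s - s') • _root_.deriv a₀ s₀‖ ≤ κ * ‖s - s'‖ := by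
  have ha' := ha.deriv had hU
  have h₀ := ha.differentiableOn had hU
  have hc : ContinuousAt (_root_.deriv a₀) s₀ :=
    ((h₀.deriv hU).differentiableAt (hU.mem_nhds hs₀)).continuousAt
  rw [Metric.tendstoLocallyUniformlyOn_iff] at ha'
  obtain ⟨t, ht, hta⟩ := ha' (κ / 2) (half_pos hκ) s₀ hs₀
  rw [hU.nhdsWithin_eq hs₀] at ht
  have h1 := hc.preimage_mem_nhds (ball_mem_nhds _ (half_pos hκ))
  obtain ⟨ε, hε, hsub⟩ := nhds_basis_closedBall.mem_iff.mp
    (inter_mem (inter_mem ht h1) (hU.mem_nhds hs₀))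
  refine ⟨ε, hε, fun s hs => (hsub hs).2, ?_⟩
  filter_upwards [hta, had] with n hn hnd s hs s' hs'
  have hder : ∀ x ∈ closedBall s₀ ε, HasDerivWithinAt (fun s => a n s - s • _root_.deriv a₀ s₀)
      (_root_.deriv (a n) x - _root_.deriv a₀ s₀) (closedBall s₀ ε) x := fun x hx => by
    have h2 := (hnd.differentiableAt (hU.mem_nhds (hsub hx).2)).hasDerivAt
    have h3 : HasDerivAt (fun s : ℂ => s • _root_.deriv a₀ s₀) (_root_.deriv a₀ s₀) x := by
      simpa using (hasDerivAt_id x).smul_const (_root_.deriv a₀ s₀)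
    exact (h2.sub h3).hasDerivWithinAt
  have hbound : ∀ x ∈ closedBall s₀ ε, ‖_root_.deriv (a n) x - _root_.deriv a₀ s₀‖ ≤ κ := fun x hx => by
    have h2 := hn x (hsub hx).1.1
    have h3 : dist (_root_.deriv a₀ x) (_root_.deriv a₀ s₀) < κ / 2 := (hsub hx).1.2
    rw [← dist_eq_norm]
    simp only [Function.comp_apply] at h2
    linarith [dist_triangle_left (_root_.deriv (a n) x) (_root_.deriv a₀ s₀) (_root_.deriv a₀ x)]
  have := (convex_closedBall s₀ ε).norm_image_sub_le_of_norm_hasDerivWithin_le hder hbound hs' hs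
  convert this using 2
  rw [sub_smul]; abel

/-- An intersection point of two holomorphic curves whose tangent vectors there span the ambient
space persists under locally uniform perturbations of both curves. -/
theorem TendstoLocallyUniformlyOn.eventually_exists_eq {a b : ι → ℂ → E} {a₀ b₀ : ℂ → E}
    (ha : TendstoLocallyUniformlyOn a a₀ p U) (hb : TendstoLocallyUniformlyOn b b₀ p U)
    (hU : IsOpen U) (had : ∀ᶠ n in p, DifferentiableOn ℂ (a n) U)
    (hbd : ∀ᶠ n in p, DifferentiableOn ℂ (b n) U) {s₀ t₀ : ℂ} (hs₀ : s₀ ∈ U) (ht₀ : t₀ ∈ U)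
    (hst : a₀ s₀ = b₀ t₀)
    (hsurj : ∀ y : E, ∃ s t : ℂ, s • _root_.deriv a₀ s₀ - t • _root_.deriv b₀ t₀ = y) :
    ∀ᶠ n in p, ∃ s ∈ U, ∃ t ∈ U, a n s = b n t := by
  let A : ℂ × ℂ →L[ℂ] E := (ContinuousLinearMap.fst ℂ ℂ ℂ).smulRight (_root_.deriv a₀ s₀) -
    (ContinuousLinearMap.snd ℂ ℂ ℂ).smulRight (_root_.deriv b₀ t₀)
  have hA : ∀ x : ℂ × ℂ, A x = x.1 • _root_.deriv a₀ s₀ - x.2 • _root_.deriv b₀ t₀ := fun x => rfl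
  have hAs : A.range = ⊤ := LinearMap.range_eq_top.mpr fun y => by
    obtain ⟨s, t, h⟩ := hsurj y
    exact ⟨(s, t), h⟩
  let r := A.nonlinearRightInverseOfSurjective hAs
  have hr : 0 < r.nnnorm := A.nonlinearRightInverseOfSurjective_nnnorm_pos hAs
  obtain ⟨κ, hκ, hκr⟩ : ∃ κ : NNReal, 0 < κ ∧ κ < r.nnnorm⁻¹ := exists_between (inv_pos.mpr hr)
  have hκ2 : (0 : ℝ) < κ / 2 := half_pos hκ
  obtain ⟨ε₁, hε₁, hsub₁, h₁⟩ := ha.exists_norm_sub_sub_smul_deriv_le hU had hs₀ hκ2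
  obtain ⟨ε₂, hε₂, hsub₂, h₂⟩ := hb.exists_norm_sub_sub_smul_deriv_le hU hbd ht₀ hκ2
  set ε := min ε₁ ε₂ with hε
  have hε0 : 0 < ε := lt_min hε₁ hε₂
  have hball : ∀ x ∈ closedBall (s₀, t₀) ε, x.1 ∈ closedBall s₀ ε₁ ∧ x.2 ∈ closedBall t₀ ε₂ := by
    intro x hx
    rw [← closedBall_prod_same] at hx
    exact ⟨closedBall_subset_closedBall (min_le_left _ _) hx.1,
      closedBall_subset_closedBall (min_le_right _ _) hx.2⟩
  have hlim : Tendsto (fun n => a n s₀ - b n t₀) p (𝓝 0) := by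
    have := (ha.tendsto_at hs₀).sub (hb.tendsto_at ht₀)
    rwa [hst, sub_self] at this
  have hδ : 0 < ((r.nnnorm : ℝ)⁻¹ - κ) * ε := by
    have : (κ : ℝ) < (r.nnnorm : ℝ)⁻¹ := by exact_mod_cast hκr
    exact mul_pos (sub_pos.mpr this) hε0
  filter_upwards [h₁, h₂, hlim.eventually (closedBall_mem_nhds 0 hδ)] with n hn₁ hn₂ hn₀
  have happ : ApproximatesLinearOn (fun x : ℂ × ℂ => a n x.1 - b n x.2) A
      (closedBall (s₀, t₀) ε) κ := by
    intro x hx y hy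
    have e1 := hn₁ _ (hball x hx).1 _ (hball y hy).1
    have e2 := hn₂ _ (hball x hx).2 _ (hball y hy).2
    have e3 : ‖x.1 - y.1‖ ≤ ‖x - y‖ := norm_fst_le (x - y)
    have e4 : ‖x.2 - y.2‖ ≤ ‖x - y‖ := norm_snd_le (x - y)
    calc ‖a n x.1 - b n x.2 - (a n y.1 - b n y.2) - A (x - y)‖
        = ‖(a n x.1 - a n y.1 - (x.1 - y.1) • _root_.deriv a₀ s₀) -
            (b n x.2 - b n y.2 - (x.2 - y.2) • _root_.deriv b₀ t₀)‖ := by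
          rw [hA, Prod.fst_sub, Prod.snd_sub]; congr 1; abel
      _ ≤ κ / 2 * ‖x.1 - y.1‖ + κ / 2 * ‖x.2 - y.2‖ := (norm_sub_le _ _).trans (add_le_add e1 e2)
      _ ≤ κ * ‖x - y‖ := by nlinarith
  obtain ⟨x, hx, hx0⟩ := happ.surjOn_closedBall_of_nonlinearRightInverse r hε0.le Subset.rfl
    (show (0 : E) ∈ _ by rw [mem_closedBall, dist_comm]; exact hn₀)
  exact ⟨x.1, hsub₁ (hball x hx).1, x.2, hsub₂ (hball x hx).2, sub_eq_zero.mp hx0⟩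

end Persistence

/-! ### Cyclic vectors of hyperbolic Lorentz isometries -/

section Hyperbolic

open scoped ComplexConjugate

theorem eq_zero_of_quadratic_of_three_roots {a b c x y z : ℂ} (hxy : x ≠ y) (hxz : x ≠ z)
    (hyz : y ≠ z) (hx : a + b * x + c * x ^ 2 = 0) (hy : a + b * y + c * y ^ 2 = 0)
    (hz : a + b * z + c * z ^ 2 = 0) : a = 0 ∧ b = 0 ∧ c = 0 := by
  have h1 : b + c * (x + y) = 0 :=
    mul_left_cancel₀ (sub_ne_zero.mpr hxy) (by linear_combination hx - hy)
  have h2 : b + c * (x + z) = 0 :=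
    mul_left_cancel₀ (sub_ne_zero.mpr hxz) (by linear_combination hx - hz)
  have h3 : c = 0 := mul_left_cancel₀ (sub_ne_zero.mpr hyz) (by linear_combination h1 - h2)
  have h4 : b = 0 := by simpa [h3] using h1
  exact ⟨by simpa [h3, h4] using hx, h4, h3⟩

/-- In `ℂ²` the vectors `w` with `⟨p, w⟩ = ⟨q, w⟩` form a line, as soon as `p ≠ q`. -/
theorem exists_inner_eq_inner_and_span {p q : C2} (hpq : p ≠ q) :
    ∃ n : C2, n ≠ 0 ∧ inner ℂ p n = inner ℂ q n ∧
      ∀ w : C2, inner ℂ p w = inner ℂ q w → ∃ k : ℂ, w = k • n := by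
  set d : C2 := p - q with hd
  have hin : ∀ w : C2, inner ℂ p w = inner ℂ q w ↔ conj (d 0) * w 0 + conj (d 1) * w 1 = 0 := by
    intro w
    rw [← sub_eq_zero, ← inner_sub_left, ← hd, PiLp.inner_apply, Fin.sum_univ_two]
    simp only [RCLike.inner_apply, mul_comm]
  have hd0 : d 0 ≠ 0 ∨ d 1 ≠ 0 := by
    by_contra! h
    exact hpq (sub_eq_zero.mp (by ext i; fin_cases i <;> simp [← hd, h.1, h.2]))
  refine ⟨!₂[-conj (d 1), conj (d 0)], ?_, (hin _).mpr (by simp; ring), fun w hw => ?_⟩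
  · intro h
    have e0 := congrArg (fun v : C2 => v 0) h
    have e1 := congrArg (fun v : C2 => v 1) h
    simp at e0 e1
    tauto
  · rw [hin] at hw
    rcases hd0 with h | h
    · have h' : conj (d 0) ≠ 0 := by simpa using h
      refine ⟨w 1 / conj (d 0), ?_⟩
      ext i; fin_cases i
      · simp; field_simp; linear_combination hw
      · simp; field_simp
    · have h' : conj (d 1) ≠ 0 := by simpa using h
      refine ⟨-w 0 / conj (d 1), ?_⟩
      ext i; fin_cases i
      · simp; field_simp
      · simp; field_simp; linear_combination hw

/-- A Lorentz isometry with exactly two fixed points on the closed ball, both on the sphere, has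
three distinct eigenvalues: two off the unit circle, belonging to the fixed points,
and a unimodular one, belonging to the orthogonal complement of the fixed points. A negative vector
with a component in each eigenspace is cyclic. -/
theorem IsLorentz.exists_cyclic_vector {M : C2 × ℂ →L[ℂ] C2 × ℂ} (hM : IsLorentz M) {p q : C2}
    (hpq : p ≠ q) (hp : ‖p‖ = 1) (hq : ‖q‖ = 1) (hMp : projAct M p = p) (hMq : projAct M q = q)
    (hfix : ∀ z : C2, ‖z‖ ≤ 1 → projAct M z = z → z = p ∨ z = q) :
    ∃ v : C2 × ℂ, ‖v.1‖ < ‖v.2‖ ∧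
      ∀ a b c : ℂ, a • v + b • M v + c • M (M v) = 0 → a = 0 ∧ b = 0 ∧ c = 0 := by
  set P : C2 × ℂ := (p, 1) with hP
  set Q : C2 × ℂ := (q, 1) with hQ
  set l := (M P).2 with hl
  set m := (M Q).2 with hm
  have hMP : M P = l • P := by have := hM.apply_eq hp.le; rwa [hMp] at this
  have hMQ : M Q = m • Q := by have := hM.apply_eq hq.le; rwa [hMq] at this
  have hl0 : l ≠ 0 := hM.snd_ne_zero hp.le
  have hm0 : m ≠ 0 := hM.snd_ne_zero hq.le
  have hPP : lorentz P P = 0 := by simp [lorentz_self, hP, hp]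
  have hQQ : lorentz Q Q = 0 := by simp [lorentz_self, hQ, hq]
  set β := lorentz P Q with hβ
  have hβre : β.re < 0 := by
    have h1 := @norm_sub_sq ℂ C2 _ _ _ p q
    rw [hp, hq] at h1
    have h2 : β.re = RCLike.re (inner ℂ p q) - 1 := by simp [hβ, lorentz, hP, hQ]
    have h3 : 0 < ‖p - q‖ := norm_pos_iff.mpr (sub_ne_zero.mpr hpq)
    rw [h2]; nlinarith
  have hβ0 : β ≠ 0 := fun h => by simp [h] at hβre
  have hQP : lorentz Q P = conj β := (lorentz_conj_symm P Q).symm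
  have hlm : conj l * m = 1 := by
    have := hM P Q
    rw [hMP, hMQ, lorentz_smul_left, lorentz_smul_right, ← hβ] at this
    exact mul_right_cancel₀ hβ0 (by linear_combination this)
  -- equal eigenvalues would make the midpoint of `p` and `q` a further fixed point
  have hlnm : l ≠ m := by
    intro h
    have h2 : M ((2⁻¹ : ℂ) • (p + q), 1) = l • ((2⁻¹ : ℂ) • (p + q), (1 : ℂ)) := by
      have h3 : (((2⁻¹ : ℂ) • (p + q), (1 : ℂ)) : C2 × ℂ) = (2⁻¹ : ℂ) • (P + Q) := by
        ext <;> simp [hP, hQ]; norm_num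
      rw [h3, map_smul, map_add, hMP, hMQ, ← h]
      module
    have h4 : ‖(2⁻¹ : ℂ) • (p + q)‖ ≤ 1 := by
      rw [norm_smul, norm_inv, Complex.norm_ofNat]
      have := norm_add_le p q
      rw [hp, hq] at this
      linarith
    have h5 : projAct M ((2⁻¹ : ℂ) • (p + q)) = (2⁻¹ : ℂ) • (p + q) := by
      rw [projAct, h2]
      simp only [Prod.smul_fst, Prod.smul_snd, smul_eq_mul, mul_one]
      rw [inv_smul_smul₀ hl0]
    rcases hfix _ h4 h5 with h6 | h6
    · apply hpq
      have : (2 : ℂ) • ((2⁻¹ : ℂ) • (p + q)) = (2 : ℂ) • p := by rw [h6]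
      rw [smul_inv_smul₀ two_ne_zero, two_smul] at this
      exact (add_left_cancel this).symm
    · apply hpq
      have : (2 : ℂ) • ((2⁻¹ : ℂ) • (p + q)) = (2 : ℂ) • q := by rw [h6]
      rw [smul_inv_smul₀ two_ne_zero, two_smul] at this
      exact add_right_cancel this
  obtain ⟨n, hn0, hpn, hspan⟩ := exists_inner_eq_inner_and_span hpq
  set N : C2 × ℂ := (n, inner ℂ p n) with hN
  have hPN : lorentz P N = 0 := by simp [lorentz, hP, hN]
  have hQN : lorentz Q N = 0 := by simp [lorentz, hQ, hN, hpn]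
  have hNP : lorentz N P = 0 := by rw [← lorentz_conj_symm, hPN, map_zero]
  have hNQ : lorentz N Q = 0 := by rw [← lorentz_conj_symm, hQN, map_zero]
  obtain ⟨k, hk⟩ : ∃ k : ℂ, M N = k • N := by
    have h1 : lorentz P (M N) = 0 := by
      have := hM P N
      rw [hMP, lorentz_smul_left, hPN] at this
      simpa [hl0] using this
    have h2 : lorentz Q (M N) = 0 := by
      have := hM Q N
      rw [hMQ, lorentz_smul_left, hQN] at this
      simpa [hm0] using this
    simp only [lorentz, hP, hQ, map_one, one_mul, sub_eq_zero] at h1 h2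
    obtain ⟨k, hk⟩ := hspan _ (h1.trans h2.symm)
    refine ⟨k, Prod.ext hk ?_⟩
    rw [← h1, hk, inner_smul_right]; rfl
  have hNN : lorentz N N ≠ 0 := by
    intro h
    rw [lorentz_self, hN] at h
    have h1 : ‖n‖ ^ 2 - ‖inner ℂ p n‖ ^ 2 = 0 := by exact_mod_cast h
    have h2 : ‖inner ℂ p n‖ = ‖p‖ * ‖n‖ := by
      rw [hp, one_mul]
      exact ((sq_eq_sq₀ (norm_nonneg _) (norm_nonneg _)).mp (sub_eq_zero.mp h1)).symm
    have hp0 : p ≠ 0 := fun h => by simp [h] at hp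
    obtain ⟨r, hr, hnr⟩ := (norm_inner_eq_norm_iff hp0 hn0).mp h2
    rw [hnr, inner_smul_right, inner_smul_right] at hpn
    have h3 := mul_left_cancel₀ hr hpn
    rw [inner_self_eq_norm_sq_to_K, hp] at h3
    exact hpq ((inner_eq_one_iff_of_norm_eq_one hq hp).mp (by rw [← h3]; simp)).symm
  have hkk : conj k * k = 1 := by
    have := hM N N
    rw [hk, lorentz_smul_left, lorentz_smul_right] at this
    exact mul_right_cancel₀ hNN (by linear_combination this)
  -- `k` is unimodular, while `conj l * m = 1` and `l ≠ m` force `l` and `m` off the unit circle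
  have hkl : k ≠ l := by
    rintro h
    rw [h] at hkk
    have : conj l ≠ 0 := by simpa using hl0
    exact hlnm (mul_left_cancel₀ this (hkk.trans hlm.symm))
  have hkm : k ≠ m := by
    rintro h
    have h1 : conj m * l = 1 := by
      have := congrArg conj hlm
      simpa [mul_comm] using this
    rw [h] at hkk
    have : conj m ≠ 0 := by simpa using hm0
    exact hlnm (mul_left_cancel₀ this (h1.trans hkk.symm))
  -- the real part of the Lorentz product of `P` and `Q` is negative, hence `P + T • Q + N` is a
  -- negative vector for large `T`
  obtain ⟨T, hT⟩ : ∃ T : ℝ, 0 < T ∧ (lorentz N N).re < 2 * T * (-β.re) := by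
    obtain ⟨T, hT⟩ := exists_gt (max 0 ((lorentz N N).re / (2 * (-β.re))))
    refine ⟨T, (le_max_left _ _).trans_lt hT, ?_⟩
    have := (le_max_right _ _).trans_lt hT
    rw [div_lt_iff₀ (by linarith)] at this
    linarith
  obtain ⟨hT0, hT⟩ := hT
  have hTc : (T : ℂ) ≠ 0 := by exact_mod_cast hT0.ne'
  set v : C2 × ℂ := P + (T : ℂ) • Q + N with hv
  refine ⟨v, ?_, fun a b c h => ?_⟩
  · have h1 : (lorentz v v).re < 0 := by
      have h2 : lorentz v v = T * β + T * conj β + lorentz N N := by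
        simp only [hv, lorentz_add_left, lorentz_add_right, lorentz_smul_left, lorentz_smul_right,
          hPP, hQQ, hPN, hQN, hNP, hNQ, hQP, ← hβ, Complex.conj_ofReal]
        ring
      rw [h2]
      simp only [Complex.add_re, Complex.mul_re, Complex.ofReal_re, Complex.ofReal_im,
        Complex.conj_re]
      nlinarith
    rw [lorentz_self, Complex.ofReal_re] at h1
    exact lt_of_pow_lt_pow_left₀ 2 (norm_nonneg _) (by linarith)
  · have hMv : M v = l • P + (T * m) • Q + k • N := by
      rw [hv, map_add, map_add, map_smul, hMP, hMQ, hk, smul_smul]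
    have hMMv : M (M v) = l ^ 2 • P + (T * m ^ 2) • Q + k ^ 2 • N := by
      rw [hMv, map_add, map_add, map_smul, map_smul, map_smul, hMP, hMQ, hk]
      module
    have key : ∀ w : C2 × ℂ, lorentz w (a • v + b • M v + c • M (M v)) = 0 := fun w => by
      rw [h]; simp [lorentz]
    have e1 := key Q
    have e2 := key P
    have e3 := key N
    rw [hMMv, hMv, hv] at e1 e2 e3
    simp only [lorentz_add_right, lorentz_smul_right, hPP, hQQ, hPN, hQN, hNP, hNQ, hQP, ← hβ]
      at e1 e2 e3
    have hβc : conj β ≠ 0 := by simpa using hβ0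
    refine eq_zero_of_quadratic_of_three_roots hlnm hkl.symm hkm.symm
      (mul_right_cancel₀ hβc (by linear_combination e1))
      (mul_right_cancel₀ (mul_ne_zero hTc hβ0) (by linear_combination e2))
      (mul_right_cancel₀ hNN (by linear_combination e3))

/-- If `M` has a cyclic negative vector, then after conjugation by an involution the flat disk
`ζ ↦ ζ • u` and its image under `M` intersect transversally at `s₀ • u`, the image of the origin.
-/
theorem IsLorentz.exists_transversal_disk {M : C2 × ℂ →L[ℂ] C2 × ℂ} (hM : IsLorentz M)
    {v : C2 × ℂ} (hv : ‖v.1‖ < ‖v.2‖)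
    (hcyc : ∀ a b c : ℂ, a • v + b • M v + c • M (M v) = 0 → a = 0 ∧ b = 0 ∧ c = 0) :
    ∃ (R : C2 × ℂ →L[ℂ] C2 × ℂ) (u : C2) (s₀ : ℂ), IsLorentz R ∧
      R ∘L R = ContinuousLinearMap.id ℂ _ ∧ ‖u‖ = 1 ∧ ‖s₀‖ < 1 ∧
      projAct (R ∘L M ∘L R) 0 = s₀ • u ∧
      ∀ y : C2, ∃ s t : ℂ, s • u - t • deriv (fun ζ : ℂ => projAct (R ∘L M ∘L R) (ζ • u)) 0 = y := by
  have hv2 : v.2 ≠ 0 := fun h => by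
    rw [h, norm_zero] at hv; exact absurd hv (norm_nonneg _).not_gt
  have hz : ‖v.2⁻¹ • v.1‖ < 1 := by
    rw [norm_smul, norm_inv, inv_mul_lt_iff₀ (norm_pos_iff.mpr hv2), mul_one]
    exact hv
  obtain ⟨R, hR, hRR, -, hR0⟩ := exists_isLorentz_projAct_eq_zero hz
  have hRR' : ∀ w, R (R w) = w := fun w => by
    rw [← ContinuousLinearMap.comp_apply, hRR, ContinuousLinearMap.id_apply]
  set M' := R ∘L M ∘L R with hM'
  have hM'L : IsLorentz M' := hR.comp (hM.comp hR)
  set e : C2 × ℂ := (0, 1) with he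
  obtain ⟨ρ, hρ, hRe⟩ : ∃ ρ : ℂ, ρ ≠ 0 ∧ R e = ρ • v := by
    have h1 := hR.apply_eq (z := 0) (by simp)
    have h2 := hR.snd_ne_zero (z := 0) (by simp)
    rw [hR0] at h1
    refine ⟨(R e).2 * v.2⁻¹, mul_ne_zero h2 (inv_ne_zero hv2), h1.trans ?_⟩
    rw [mul_smul]
    congr 1
    ext <;> simp [hv2]
  have hcyc' : ∀ a b c : ℂ, a • e + b • M' e + c • M' (M' e) = 0 → a = 0 ∧ b = 0 ∧ c = 0 := by
    intro a b c h
    have h1 : R (M' e) = ρ • M v := by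
      simp only [hM', ContinuousLinearMap.comp_apply, hRR', hRe, map_smul]
    have h2 : R (M' (M' e)) = ρ • M (M v) := by
      simp only [hM', ContinuousLinearMap.comp_apply, hRR', hRe, map_smul]
    have h3 := congrArg R h
    rw [map_add, map_add, map_smul, map_smul, map_smul, hRe, h1, h2, map_zero] at h3
    apply hcyc
    apply smul_right_injective _ hρ
    simp only [smul_zero]
    rw [← h3]; module
  set y := projAct M' 0 with hy
  set w := M' e with hw
  have hw2 : w.2 ≠ 0 := hM'L.snd_ne_zero (z := 0) (by simp)
  have hwy : w = w.2 • (y, (1 : ℂ)) := hM'L.apply_eq (z := 0) (by simp)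
  have hy0 : y ≠ 0 := by
    intro h
    have := (hcyc' (-w.2) 1 0 (by
      rw [hwy, h, he]; simp)).2.1
    exact one_ne_zero this
  have hny : (‖y‖ : ℂ) ≠ 0 := by simpa using hy0
  set u : C2 := (‖y‖ : ℂ)⁻¹ • y with hu
  have hu1 : ‖u‖ = 1 := by simp [hu, norm_smul, hy0]
  have hyu : y = (‖y‖ : ℂ) • u := by rw [hu, smul_inv_smul₀ hny]
  set x := M' (u, 0) with hx
  -- otherwise the plane spanned by `(u, 0)` and `(0, 1)` would contain the first three iterates
  have hxu : ∀ k : ℂ, x.1 ≠ k • u := by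
    intro k hk
    have h1 : (w.2 * ‖y‖) • ((u, 0) : C2 × ℂ) = w - w.2 • e := by
      rw [eq_sub_iff_add_eq]
      conv_rhs => rw [hwy, hyu]
      ext <;> simp only [he, Prod.smul_mk, Prod.mk_add_mk, mul_smul] <;> simp
    obtain ⟨τ, h2⟩ : ∃ τ : ℂ, x = k • ((u, 0) : C2 × ℂ) + τ • e :=
      ⟨x.2, by ext <;> simp [he, hk]⟩
    have h3 : M' w = k • (w - w.2 • e) + (w.2 * ‖y‖ * τ) • e + w.2 • w := by
      conv_lhs => rw [← sub_add_cancel w (w.2 • e), ← h1]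
      rw [map_add, map_smul, map_smul, ← hx, h2, smul_add, smul_comm, h1, smul_smul, ← hw]
    have h4 := (hcyc' (k * w.2 - w.2 * ‖y‖ * τ) (-k - w.2) 1 (by
      rw [h3]; module)).2.2
    exact one_ne_zero h4
  have hderiv : HasDerivAt (fun ζ : ℂ => projAct M' (ζ • u))
      (w.2⁻¹ • x.1 - (w.2⁻¹ * x.2 * ‖y‖) • u) 0 := by
    have hcurve : ∀ ζ : ℂ, M' (ζ • u, 1) = ζ • x + w := fun ζ => by
      rw [hx, hw, ← map_smul, ← map_add]; congr 1; ext <;> simp [he]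
    have h1 : HasDerivAt (fun ζ : ℂ => (ζ • x + w).2) x.2 0 := by
      simpa using ((hasDerivAt_id (0 : ℂ)).mul_const x.2).add_const w.2
    have h2 : HasDerivAt (fun ζ : ℂ => (ζ • x + w).1) x.1 0 := by
      simpa using ((hasDerivAt_id (0 : ℂ)).smul_const x.1).add_const w.1
    have h3 := (h1.inv (by simpa using hw2)).smul h2
    simp only [projAct, hcurve]
    refine h3.congr_deriv ?_
    have hw1 : w.1 = (w.2 * ‖y‖) • u := by
      conv_lhs => rw [hwy, hyu]
      simp [mul_smul]
    simp only [Pi.inv_apply, zero_smul, zero_add, hw1, smul_smul, sub_eq_add_neg, ← neg_smul]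
    congr 2
    field_simp
  refine ⟨R, u, ‖y‖, hR, hRR, hu1, ?_, hyu, ?_⟩
  · rw [Complex.norm_real, norm_norm]
    exact hM'L.norm_projAct_lt (by simp)
  rw [hderiv.deriv]
  set d := w.2⁻¹ • x.1 - (w.2⁻¹ * x.2 * ‖y‖) • u with hd
  let A : ℂ × ℂ →ₗ[ℂ] C2 := (LinearMap.fst ℂ ℂ ℂ).smulRight u - (LinearMap.snd ℂ ℂ ℂ).smulRight d
  have hA : ∀ a : ℂ × ℂ, A a = a.1 • u - a.2 • d := fun a => rfl
  have hu0 : u ≠ 0 := fun h => by simp [h] at hu1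
  have hinj : Function.Injective A := by
    rw [injective_iff_map_eq_zero]
    rintro ⟨s, t⟩ h
    rw [hA] at h
    have ht : t = 0 := by
      by_contra ht
      apply hxu (w.2 * t⁻¹ * s + x.2 * ‖y‖)
      have h1 : d = (t⁻¹ * s) • u := by
        rw [mul_smul, sub_eq_zero.mp h, inv_smul_smul₀ ht]
      have h2 : x.1 = w.2 • (d + (w.2⁻¹ * x.2 * ‖y‖) • u) := by
        rw [hd, sub_add_cancel, smul_inv_smul₀ hw2]
      rw [h2, h1, ← add_smul, smul_smul]
      congr 1
      field_simp
    subst ht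
    have hs : s = 0 := by simpa [hu0] using h
    rw [hs]; rfl
  have hsurj := (LinearMap.injective_iff_surjective_of_finrank_eq_finrank (f := A) (by simp)).mp hinj
  intro z
  obtain ⟨⟨s, t⟩, h⟩ := hsurj z
  exact ⟨s, t, h⟩

end Hyperbolic

/-! ### Holomorphic maps on the ball as an open submanifold -/

section Ball

open scoped Classical in
/-- The retraction of `ℂ²` to the ball that is the identity on the ball and the constant `0`
elsewhere. -/
noncomputable def toBall (z : C2) : ball2 :=
  if h : z ∈ ball (0 : C2) 1 then ⟨z, h⟩ else ⟨0, mem_ball_self one_pos⟩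

theorem toBall_coe (z : ball2) : toBall z = z := dif_pos z.2

theorem coe_toBall {z : C2} (hz : z ∈ ball (0 : C2) 1) : (toBall z : C2) = z := by
  rw [toBall, dif_pos hz]

theorem contMDiffAt_toBall {z : C2} (hz : z ∈ ball (0 : C2) 1) :
    ContMDiffAt 𝓘(ℂ, C2) 𝓘(ℂ, C2) ω toBall z := by
  have : ContMDiffAt 𝓘(ℂ, C2) 𝓘(ℂ, C2) ω (fun x : ball2 => toBall x) ⟨z, hz⟩ := by
    simp only [toBall_coe]; exact contMDiffAt_id
  exact contMDiffAt_subtype_iff.mp this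

theorem differentiableOn_coe_comp_toBall {φ : ball2 → ball2}
    (hφ : ContMDiff 𝓘(ℂ, C2) 𝓘(ℂ, C2) ω φ) :
    DifferentiableOn ℂ (fun z => (φ (toBall z) : C2)) (ball 0 1) := fun z hz => by
  have h : ContMDiffAt 𝓘(ℂ, C2) 𝓘(ℂ, C2) ω (fun z => (φ (toBall z) : C2)) z :=
    (contMDiff_subtype_val.comp hφ).contMDiffAt.comp z (contMDiffAt_toBall hz)
  exact ((contMDiffAt_iff_contDiffAt.mp h).differentiableAt (by simp)).differentiableWithinAt

theorem exists_isLorentz_of_holAut (φ : holAut) :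
    ∃ M : C2 × ℂ →L[ℂ] C2 × ℂ, IsLorentz M ∧ ∀ z : ball2, ((φ • z : ball2) : C2) = projAct M z := by
  obtain ⟨M, hM, h⟩ := exists_isLorentz_of_ball_automorphism
    (differentiableOn_coe_comp_toBall φ.2.1) (differentiableOn_coe_comp_toBall φ.2.2)
    (fun z _ => (φ.1 (toBall z)).2) (fun z _ => (φ.1.symm (toBall z)).2)
    (fun z hz => by rw [toBall_coe, Homeomorph.symm_apply_apply, coe_toBall hz])
  refine ⟨M, hM, fun z => ?_⟩
  rw [← h z z.2, toBall_coe]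
  rfl

end Ball

/-! ### Holomorphic disks in the quotient and their lifts -/

namespace BallQuotient

variable (Γ : Subgroup holAut) (hΓ : IsKleinian Γ)

theorem exists_localInverseAt_proj_eventuallyEq (b u : ball2)
    (hu : proj Γ hΓ u ∈ ((isLocalHomeomorph_proj Γ hΓ).localInverseAt b).source) :
    ∃ γ ∈ Γ, ∀ᶠ z in 𝓝 u,
      (isLocalHomeomorph_proj Γ hΓ).localInverseAt b (proj Γ hΓ z) = γ • z := by
  have hf := isLocalHomeomorph_proj Γ hΓ
  have hcov := isQuotientCoveringMap_proj Γ hΓ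
  obtain ⟨γ, hγ⟩ := hcov.apply_eq_iff_mem_orbit.mp (hf.apply_localInverseAt_of_mem hu)
  have hmem : γ • u ∈ (hf.localInverseAt b).target := by
    change (fun m : Γ => m • u) γ ∈ _
    rw [hγ]
    exact (hf.localInverseAt b).map_source hu
  have hcont : Continuous (fun x : ball2 => γ • x) := γ.1.1.continuous
  refine ⟨γ.1, γ.2, ?_⟩
  filter_upwards [hcont.continuousAt.preimage_mem_nhds
    ((hf.localInverseAt b).open_target.mem_nhds hmem)] with z hz
  have h1 := (hf.localInverseAt b).right_inv hz
  rw [hf.localInverseAt_symm, hcov.map_smul γ] at h1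
  exact h1

/-- The inverse branch of the quotient map through the chosen representative of `x` is the chart
at `x`, read as a map into the ball. -/
theorem contMDiffAt_localInverseAt_out (x : BallQuotient Γ hΓ) :
    ContMDiffAt 𝓘(ℂ, C2) 𝓘(ℂ, C2) ω
      ((isLocalHomeomorph_proj Γ hΓ).localInverseAt (out Γ hΓ x)) x := by
  have h : ContMDiffAt 𝓘(ℂ, C2) 𝓘(ℂ, C2) ω (fun y =>
      ((isLocalHomeomorph_proj Γ hΓ).localInverseAt (out Γ hΓ x) y : C2)) x :=
    contMDiffAt_extChartAt (I := 𝓘(ℂ, C2)) (n := ω) (x := x)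
  have h2 := (contMDiffAt_toBall
    ((isLocalHomeomorph_proj Γ hΓ).localInverseAt (out Γ hΓ x) x).2).comp x h
  simpa only [Function.comp_def, toBall_coe] using h2

theorem mem_source_localInverseAt_out (x : BallQuotient Γ hΓ) :
    x ∈ ((isLocalHomeomorph_proj Γ hΓ).localInverseAt (out Γ hΓ x)).source := by
  have h : proj Γ hΓ (out Γ hΓ x) = x := Quotient.out_eq x
  have := (isLocalHomeomorph_proj Γ hΓ).apply_self_mem_localInverseAt_source (x := out Γ hΓ x)
  rwa [h] at this

theorem contMDiff_proj : ContMDiff 𝓘(ℂ, C2) 𝓘(ℂ, C2) ω (proj Γ hΓ) := by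
  intro u
  rw [contMDiffAt_iff_target]
  refine ⟨(isLocalHomeomorph_proj Γ hΓ).continuous.continuousAt, ?_⟩
  obtain ⟨γ, -, hγ⟩ := exists_localInverseAt_proj_eventuallyEq Γ hΓ _ u
    (mem_source_localInverseAt_out Γ hΓ (proj Γ hΓ u))
  have h : ContMDiffAt 𝓘(ℂ, C2) 𝓘(ℂ, C2) ω (fun z : ball2 => ((γ • z : ball2) : C2)) u :=
    (contMDiff_subtype_val.comp γ.2.1).contMDiffAt
  refine h.congr_of_eventuallyEq ?_
  filter_upwards [hγ] with z hz
  rw [← hz]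
  rfl

theorem exists_contMDiffAt_leftInverse_proj (u : ball2) :
    ∃ τ : BallQuotient Γ hΓ → ball2, ContMDiffAt 𝓘(ℂ, C2) 𝓘(ℂ, C2) ω τ (proj Γ hΓ u) ∧
      ∀ᶠ z in 𝓝 u, τ (proj Γ hΓ z) = z := by
  obtain ⟨γ, -, hγ⟩ := exists_localInverseAt_proj_eventuallyEq Γ hΓ _ u
    (mem_source_localInverseAt_out Γ hΓ (proj Γ hΓ u))
  refine ⟨fun x => γ⁻¹ • (isLocalHomeomorph_proj Γ hΓ).localInverseAt
    (out Γ hΓ (proj Γ hΓ u)) x, ?_, ?_⟩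
  · have h : ContMDiff 𝓘(ℂ, C2) 𝓘(ℂ, C2) ω (fun z : ball2 => γ⁻¹ • z) := (γ⁻¹).2.1
    exact h.contMDiffAt.comp _ (contMDiffAt_localInverseAt_out Γ hΓ _)
  · filter_upwards [hγ] with z hz
    rw [hz, inv_smul_smul]

/-- The quotient map, extended to a map on `ℂ²` with junk values off the ball. -/
noncomputable def projExt (z : C2) : BallQuotient Γ hΓ := proj Γ hΓ (toBall z)

theorem mdifferentiableAt_projExt {z : C2} (hz : z ∈ ball (0 : C2) 1) :
    MDifferentiableAt 𝓘(ℂ, C2) 𝓘(ℂ, C2) (projExt Γ hΓ) z :=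
  ((contMDiff_proj Γ hΓ).contMDiffAt.comp z (contMDiffAt_toBall hz)).mdifferentiableAt (by simp)

theorem exists_mdifferentiableAt_leftInverse_projExt {b : C2} (hb : b ∈ ball (0 : C2) 1) :
    ∃ τ : BallQuotient Γ hΓ → C2, MDifferentiableAt 𝓘(ℂ, C2) 𝓘(ℂ, C2) τ (projExt Γ hΓ b) ∧
      ∀ᶠ z in 𝓝 b, τ (projExt Γ hΓ z) = z := by
  obtain ⟨τ, hτ, h⟩ := exists_contMDiffAt_leftInverse_proj Γ hΓ (toBall b)
  refine ⟨fun x => τ x, ?_, ?_⟩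
  · exact (contMDiff_subtype_val.contMDiffAt.comp _ hτ).mdifferentiableAt (by simp)
  · filter_upwards [(contMDiffAt_toBall hb).continuousAt.eventually h,
      isOpen_ball.mem_nhds hb] with z hz hzb
    rw [projExt, hz, coe_toBall hzb]

/-- The tangent vector of `𝔹²/Γ` represented by the vector `V` at the point `b` of the ball. -/
noncomputable def tangentProj (b V : C2) : TangentBundle 𝓘(ℂ, C2) (BallQuotient Γ hΓ) :=
  ⟨projExt Γ hΓ b, mfderiv 𝓘(ℂ, C2) 𝓘(ℂ, C2) (projExt Γ hΓ) b V⟩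

theorem mfderiv_projExt_injective {b : C2} (hb : b ∈ ball (0 : C2) 1) :
    Function.Injective (mfderiv 𝓘(ℂ, C2) 𝓘(ℂ, C2) (projExt Γ hΓ) b) := by
  obtain ⟨τ, hτ, h⟩ := exists_mdifferentiableAt_leftInverse_projExt Γ hΓ hb
  have h1 := hτ.hasMFDerivAt.comp b (mdifferentiableAt_projExt Γ hΓ hb).hasMFDerivAt
  have h2 : HasMFDerivAt 𝓘(ℂ, C2) 𝓘(ℂ, C2) (τ ∘ projExt Γ hΓ) b
      (ContinuousLinearMap.id ℂ (TangentSpace 𝓘(ℂ, C2) b)) :=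
    (hasMFDerivAt_id b).congr_of_eventuallyEq h
  have h3 := hasMFDerivAt_unique h1 h2
  intro x y hxy
  have e : ∀ w, mfderiv 𝓘(ℂ, C2) 𝓘(ℂ, C2) τ (projExt Γ hΓ b)
      (mfderiv 𝓘(ℂ, C2) 𝓘(ℂ, C2) (projExt Γ hΓ) b w) = w := fun w =>
    congrArg (fun L => L w) h3
  exact (e x).symm.trans ((congrArg _ hxy).trans (e y))

theorem isHolDisk_projExt_comp {F : ℂ → C2} (hF : DifferentiableOn ℂ F (ball 0 1))
    (hFm : MapsTo F (ball 0 1) (ball 0 1)) :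
    IsHolDisk C2 (BallQuotient Γ hΓ) (projExt Γ hΓ ∘ F) := fun ζ hζ =>
  ((mdifferentiableAt_projExt Γ hΓ (hFm hζ)).comp ζ
    (hF.differentiableAt (isOpen_ball.mem_nhds hζ)).mdifferentiableAt).mdifferentiableWithinAt

theorem mfderiv_projExt_comp {F : ℂ → C2} {ζ : ℂ} (hF : DifferentiableAt ℂ F ζ)
    (hFζ : F ζ ∈ ball (0 : C2) 1) :
    mfderiv 𝓘(ℂ, ℂ) 𝓘(ℂ, C2) (projExt Γ hΓ ∘ F) ζ (1 : ℂ) =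
      mfderiv 𝓘(ℂ, C2) 𝓘(ℂ, C2) (projExt Γ hΓ) (F ζ) (deriv F ζ) := by
  have h := (mdifferentiableAt_projExt Γ hΓ hFζ).hasMFDerivAt.comp ζ
    hF.hasFDerivAt.hasMFDerivAt
  rw [h.mfderiv]
  rfl

theorem kobayashiMetric_tangentProj_le_one {F : ℂ → C2} (hF : DifferentiableOn ℂ F (ball 0 1))
    (hFm : MapsTo F (ball 0 1) (ball 0 1)) :
    kobayashiMetric C2 (BallQuotient Γ hΓ) (tangentProj Γ hΓ (F 0) (deriv F 0)) ≤ 1 := by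
  refine sInf_le ⟨1, one_pos, by simp, projExt Γ hΓ ∘ F, isHolDisk_projExt_comp Γ hΓ hF hFm, ?_⟩
  have h := mfderiv_projExt_comp Γ hΓ (hF.differentiableAt (ball_mem_nhds _ one_pos))
    (hFm (mem_ball_self one_pos))
  rw [Complex.ofReal_one]
  exact congrArg (Bundle.TotalSpace.mk _) (h.trans (one_smul ℂ _).symm)

/-- A holomorphic disk in `𝔹²/Γ` lifts to the ball. -/
theorem exists_lift_of_isHolDisk {f : ℂ → BallQuotient Γ hΓ}
    (hf : IsHolDisk C2 (BallQuotient Γ hΓ) f) {b : C2} (hb : b ∈ ball (0 : C2) 1)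
    (hfb : f 0 = projExt Γ hΓ b) :
    ∃ F : ℂ → C2, DifferentiableOn ℂ F (ball 0 1) ∧ MapsTo F (ball 0 1) (ball 0 1) ∧ F 0 = b ∧
      ∀ ζ ∈ ball (0 : ℂ) 1, projExt Γ hΓ (F ζ) = f ζ := by
  have h0 : (0 : ℂ) ∈ ball (0 : ℂ) 1 := mem_ball_self one_pos
  have : ContractibleSpace (ball (0 : ℂ) 1) :=
    (convex_ball (0 : ℂ) 1).contractibleSpace ⟨0, h0⟩
  have : LocallyPathConnectedSpace (ball (0 : ℂ) 1) := isOpen_ball.locallyPathConnectedSpace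
  let f' : C(ball (0 : ℂ) 1, BallQuotient Γ hΓ) := ⟨(ball (0 : ℂ) 1).domRestrict f,
    continuousOn_iff_continuous_domRestrict.mp hf.continuousOn⟩
  obtain ⟨g, ⟨hg0, hg⟩, -⟩ :=
    (isQuotientCoveringMap_proj Γ hΓ).isCoveringMap.existsUnique_continuousMap_lifts f' ⟨0, h0⟩
      (toBall b) hfb.symm
  classical
  let F : ℂ → C2 := fun ζ => if h : ζ ∈ ball (0 : ℂ) 1 then g ⟨ζ, h⟩ else 0
  have hFg : ∀ ζ (h : ζ ∈ ball (0 : ℂ) 1), F ζ = g ⟨ζ, h⟩ := fun ζ h => dif_pos h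
  have hFm : MapsTo F (ball 0 1) (ball 0 1) := fun ζ h => by rw [hFg ζ h]; exact (g ⟨ζ, h⟩).2
  have hFf : ∀ ζ ∈ ball (0 : ℂ) 1, projExt Γ hΓ (F ζ) = f ζ := fun ζ h => by
    rw [hFg ζ h, projExt, toBall_coe]
    exact congrFun hg ⟨ζ, h⟩
  have hFc : ContinuousOn F (ball 0 1) := by
    rw [continuousOn_iff_continuous_domRestrict]
    have : (ball (0 : ℂ) 1).domRestrict F = fun ζ => (g ζ : C2) := funext fun ζ => hFg ζ ζ.2
    rw [this]
    exact continuous_subtype_val.comp g.continuous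
  refine ⟨F, fun ζ hζ => ?_, hFm, ?_, hFf⟩
  · obtain ⟨τ, hτ, hτσ⟩ := exists_mdifferentiableAt_leftInverse_projExt Γ hΓ (hFm hζ)
    have hnhds := isOpen_ball.mem_nhds hζ
    have h1 : MDifferentiableAt 𝓘(ℂ, ℂ) 𝓘(ℂ, C2) (τ ∘ f) ζ := by
      rw [hFf ζ hζ] at hτ
      exact hτ.comp ζ ((hf ζ hζ).mdifferentiableAt hnhds)
    have h2 : DifferentiableAt ℂ F ζ := by
      refine (mdifferentiableAt_iff_differentiableAt.mp h1).congr_of_eventuallyEq ?_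
      filter_upwards [(hFc.continuousAt hnhds).eventually hτσ, hnhds] with w hw hwb
      rw [Function.comp_apply, ← hFf w hwb, hw]
    exact h2.differentiableWithinAt
  · rw [hFg 0 h0, hg0, coe_toBall hb]

/-- If the injective metric does not exceed `1` at the tangent vector represented by `(b, V)`, then
for each `c < 1` there is a disk in the ball with derivative `c • V` at `b` which embeds into
`𝔹²/Γ`. -/
theorem exists_injOn_disk_of_injKobayashiMetric_le_one {b V : C2} (hb : b ∈ ball (0 : C2) 1)
    (h : injKobayashiMetric C2 (BallQuotient Γ hΓ) (tangentProj Γ hΓ b V) ≤ 1)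
    {c : ℝ} (hc : c ∈ Ioo (0 : ℝ) 1) :
    ∃ F : ℂ → C2, DifferentiableOn ℂ F (ball 0 1) ∧ MapsTo F (ball 0 1) (ball 0 1) ∧ F 0 = b ∧
      deriv F 0 = (c : ℂ) • V ∧ InjOn (projExt Γ hΓ ∘ F) (ball 0 1) := by
  have h1c : (1 : ℝ≥0∞) < ENNReal.ofReal (1 / c) := by
    rw [← ENNReal.ofReal_one]
    exact (ENNReal.ofReal_lt_ofReal_iff (one_div_pos.mpr hc.1)).mpr (one_lt_one_div hc.1 hc.2)
  obtain ⟨t, ⟨c', hc', rfl, f, hf, hinj, htan⟩, ht⟩ := sInf_lt_iff.mp (h.trans_lt h1c)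
  rw [ENNReal.ofReal_lt_ofReal_iff (one_div_pos.mpr hc.1), one_div_lt_one_div hc' hc.1] at ht
  obtain ⟨F, hF, hFm, hF0, hFf⟩ := exists_lift_of_isHolDisk Γ hΓ hf hb
    (congrArg Bundle.TotalSpace.proj htan)
  have h0 : (0 : ℂ) ∈ ball (0 : ℂ) 1 := mem_ball_self one_pos
  have hFd : deriv F 0 = (c' : ℂ) • V := by
    have h2 := mfderiv_projExt_comp Γ hΓ (hF.differentiableAt (ball_mem_nhds _ one_pos)) (hFm h0)
    have h3 : projExt Γ hΓ ∘ F =ᶠ[𝓝 0] f := by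
      filter_upwards [ball_mem_nhds (0 : ℂ) one_pos] with ζ hζ using hFf ζ hζ
    rw [h3.mfderiv_eq] at h2
    have h4 : (mfderiv 𝓘(ℂ, ℂ) 𝓘(ℂ, C2) f 0 (1 : ℂ) : C2) =
        (c' : ℂ) • (mfderiv 𝓘(ℂ, C2) 𝓘(ℂ, C2) (projExt Γ hΓ) b V : C2) :=
      congrArg (fun p : TangentBundle 𝓘(ℂ, C2) (BallQuotient Γ hΓ) => (p.2 : C2)) htan
    subst hF0
    apply mfderiv_projExt_injective Γ hΓ hb
    exact h2.symm.trans (h4.trans (map_smul _ _ _).symm)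
  -- precomposition with a dilation lowers the derivative from `c' • V` to `c • V`
  have hρ0 : 0 < c / c' := div_pos hc.1 hc'
  have hρ1 : c / c' < 1 := (div_lt_one hc').mpr ht
  have hsub : MapsTo (fun ζ : ℂ => ((c / c' : ℝ) : ℂ) * ζ) (ball 0 1) (ball 0 1) := fun ζ hζ => by
    rw [mem_ball_zero_iff] at hζ ⊢
    rw [norm_mul, Complex.norm_real, Real.norm_of_nonneg hρ0.le]
    nlinarith [norm_nonneg ζ]
  refine ⟨fun ζ => F (((c / c' : ℝ) : ℂ) * ζ), hF.comp (by fun_prop) hsub, hFm.comp hsub,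
    by simpa using hF0, ?_, ?_⟩
  · rw [deriv_comp_mul_left, mul_zero, hFd, smul_smul]
    congr 1
    have : (c' : ℂ) ≠ 0 := by exact_mod_cast hc'.ne'
    push_cast
    field_simp
  · intro x hx y hy hxy
    simp only [Function.comp_apply] at hxy
    rw [hFf _ (hsub hx), hFf _ (hsub hy)] at hxy
    have := hinj (hsub hx) (hsub hy) hxy
    exact mul_left_cancel₀ (by exact_mod_cast hρ0.ne') this

end BallQuotient

/-! ### Hyperbolic automorphisms obstruct the equality of the two metrics -/

theorem IsHyperbolic.smul_ne {φ : holAut} (hφ : IsHyperbolic φ) (z : ball2) : φ • z ≠ z := by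
  obtain ⟨F, -, hFφ, p, q, -, hp, hq, hfix⟩ := hφ
  intro h
  have hz : ‖(z : C2)‖ < 1 := mem_ball_zero_iff.mp z.2
  have h1 : (z : C2) ∈ ({p, q} : Set C2) := by
    rw [← hfix]
    exact ⟨ball_subset_closedBall z.2, by rw [hFφ, h]⟩
  rcases h1 with h1 | h1
  · rw [h1, mem_sphere_zero_iff_norm.mp hp] at hz; exact lt_irrefl _ hz
  · rw [h1, mem_sphere_zero_iff_norm.mp hq] at hz; exact lt_irrefl _ hz

theorem IsHyperbolic.exists_cyclic_vector {φ : holAut} (hφ : IsHyperbolic φ)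
    {M : C2 × ℂ →L[ℂ] C2 × ℂ} (hM : IsLorentz M)
    (hMφ : ∀ z : ball2, ((φ • z : ball2) : C2) = projAct M z) :
    ∃ v : C2 × ℂ, ‖v.1‖ < ‖v.2‖ ∧
      ∀ a b c : ℂ, a • v + b • M v + c • M (M v) = 0 → a = 0 ∧ b = 0 ∧ c = 0 := by
  obtain ⟨F, hF, hFφ, p, q, hpq, hp, hq, hfix⟩ := hφ
  have hFM : EqOn F (projAct M) (closedBall 0 1) := by
    refine EqOn.of_subset_closure (s := ball 0 1) (fun z hz => ?_) hF (fun z hz => ?_)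
      ball_subset_closedBall (closure_ball (0 : C2) one_ne_zero).ge
    · exact (hFφ ⟨z, hz⟩).trans (hMφ ⟨z, hz⟩)
    · exact (hM.differentiableAt_projAct
        (mem_closedBall_zero_iff.mp hz)).continuousAt.continuousWithinAt
  have hfix' : ∀ z : C2, z ∈ ({p, q} : Set C2) ↔ ‖z‖ ≤ 1 ∧ projAct M z = z := fun z => by
    rw [← hfix, mem_ofPred_eq, mem_closedBall_zero_iff]
    refine and_congr_right fun hz => ?_
    rw [hFM (mem_closedBall_zero_iff.mpr hz)]
  exact hM.exists_cyclic_vector hpq (mem_sphere_zero_iff_norm.mp hp)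
    (mem_sphere_zero_iff_norm.mp hq) ((hfix' p).mp (by simp)).2 ((hfix' q).mp (by simp)).2
    fun z hz h => (hfix' z).mpr ⟨hz, h⟩

theorem mainTheorem2 (Γ : Subgroup holAut) (hΓ : IsKleinian Γ)
    (hhyp : ∃ φ ∈ Γ, IsHyperbolic φ) :
    kobayashiMetric C2 (BallQuotient Γ hΓ) ≠ injKobayashiMetric C2 (BallQuotient Γ hΓ) := by
  obtain ⟨φ, hφΓ, hφ⟩ := hhyp
  intro heq
  obtain ⟨M, hM, hMφ⟩ := exists_isLorentz_of_holAut φ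
  obtain ⟨v, hv, hcyc⟩ := hφ.exists_cyclic_vector hM hMφ
  obtain ⟨R, u, s₀, hR, hRR, hu, hs₀, hM0, hsurj⟩ := hM.exists_transversal_disk hv hcyc
  set M' := R ∘L M ∘L R with hM'
  have hM'L : IsLorentz M' := hR.comp (hM.comp hR)
  have hdiff : ∀ {N : C2 × ℂ →L[ℂ] C2 × ℂ}, IsLorentz N →
      DifferentiableOn ℂ (projAct N) (ball 0 1) := fun hN z hz =>
    (hN.differentiableAt_projAct (mem_ball_zero_iff.mp hz).le).differentiableWithinAt
  have hmaps : ∀ {N : C2 × ℂ →L[ℂ] C2 × ℂ}, IsLorentz N →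
      MapsTo (projAct N) (ball 0 1) (ball 0 1) := fun hN z hz =>
    mem_ball_zero_iff.mpr (hN.norm_projAct_lt (mem_ball_zero_iff.mp hz))
  have hRinv : ∀ z ∈ ball (0 : C2) 1, projAct R (projAct R z) = z := fun z hz => by
    rw [← hR.projAct_comp hR (mem_ball_zero_iff.mp hz), hRR, projAct_id]
  have h0 : (0 : C2) ∈ ball (0 : C2) 1 := mem_ball_self one_pos
  have hflat : MapsTo (fun ζ : ℂ => ζ • u) (ball 0 1) (ball 0 1) := fun ζ hζ => by
    simpa [norm_smul, hu] using hζ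
  -- the geodesic disk which meets its image under `φ` transversally
  set G : ℂ → C2 := fun ζ => projAct R (ζ • u) with hG
  have hGd : DifferentiableOn ℂ G (ball 0 1) := (hdiff hR).comp (by fun_prop) hflat
  have hGm : MapsTo G (ball 0 1) (ball 0 1) := (hmaps hR).comp hflat
  have hle : injKobayashiMetric C2 (BallQuotient Γ hΓ)
      (BallQuotient.tangentProj Γ hΓ (G 0) (deriv G 0)) ≤ 1 := by
    rw [← heq]
    exact BallQuotient.kobayashiMetric_tangentProj_le_one Γ hΓ hGd hGm
  have hG0 : G 0 ∈ ball (0 : C2) 1 := hGm (mem_ball_self one_pos)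
  have hRG : projAct R (G 0) = 0 := by simp only [hG, zero_smul]; exact hRinv 0 h0
  choose! F hFd hFm hF0 hF' hFinj using fun (c : ℝ) (hc : c ∈ Ioo (0 : ℝ) 1) =>
    BallQuotient.exists_injOn_disk_of_injKobayashiMetric_le_one Γ hΓ hG0 hle hc
  have hRat : HasFDerivAt (projAct R) (fderiv ℂ (projAct R) (G 0)) (G 0) :=
    (hR.differentiableAt_projAct (mem_ball_zero_iff.mp hG0).le).hasFDerivAt
  have hRG' : fderiv ℂ (projAct R) (G 0) (deriv G 0) = u := by
    have h1 := hRat.comp_hasDerivAt (0 : ℂ)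
      (hGd.differentiableAt (ball_mem_nhds _ one_pos)).hasDerivAt
    have h2 : HasDerivAt (fun ζ : ℂ => ζ • u) u 0 := by
      simpa using (hasDerivAt_id (0 : ℂ)).smul_const u
    refine h1.unique (h2.congr_of_eventuallyEq ?_)
    filter_upwards [ball_mem_nhds (0 : ℂ) one_pos] with ζ hζ using hRinv _ (hflat hζ)
  have hRFd : ∀ c ∈ Ioo (0 : ℝ) 1, DifferentiableOn ℂ (projAct R ∘ F c) (ball 0 1) :=
    fun c hc => (hdiff hR).comp (hFd c hc) (hFm c hc)
  have hRFm : ∀ c ∈ Ioo (0 : ℝ) 1, MapsTo (projAct R ∘ F c) (ball 0 1) (ball 0 1) :=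
    fun c hc => (hmaps hR).comp (hFm c hc)
  have hconv := tendstoLocallyUniformlyOn_smul_of_deriv (F := fun c => projAct R ∘ F c) hu hRFd hRFm
    (fun c hc => by rw [Function.comp_apply, hF0 c hc, hRG])
    (fun c hc => by
      have h1 := ((hFd c hc).differentiableAt (ball_mem_nhds _ one_pos)).hasDerivAt
      have h2 : HasFDerivAt (projAct R) (fderiv ℂ (projAct R) (G 0)) (F c 0) := by
        rw [hF0 c hc]; exact hRat
      rw [(h2.comp_hasDerivAt (0 : ℂ) h1).deriv, hF' c hc, map_smul, hRG'])
  have hconv' := hconv.continuous_comp (g := projAct M') (by fun_prop) fun ζ hζ =>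
    (hM'L.differentiableAt_projAct (mem_ball_zero_iff.mp (hflat hζ)).le).continuousAt
  have hIoo : ∀ᶠ c in 𝓝[<] (1 : ℝ), c ∈ Ioo (0 : ℝ) 1 := Ioo_mem_nhdsLT one_pos
  have hflat' : deriv (fun ζ : ℂ => ζ • u) s₀ = u := by
    simpa using ((hasDerivAt_id s₀).smul_const u).deriv
  have hmeet := hconv.eventually_exists_eq hconv' isOpen_ball
    (hIoo.mono hRFd) (hIoo.mono fun c hc => (hdiff hM'L).comp (hRFd c hc) (hRFm c hc))
    (s₀ := s₀) (t₀ := 0) (by simpa using hs₀) (mem_ball_self one_pos)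
    (by simp only [Function.comp_apply, zero_smul, hM0])
    (fun y => by rw [hflat']; exact hsurj y)
  obtain ⟨c, hc, s, hs, t, ht, hst⟩ := (hIoo.and hmeet).exists
  have hFs := hFm c hc hs
  have hFt := hFm c hc ht
  -- undoing the conjugation, `F c s` is the image of `F c t` under `φ`
  have key : F c s = ((φ • toBall (F c t) : ball2) : C2) := by
    simp only [Function.comp_apply] at hst
    rw [hM', hR.projAct_comp (hM.comp hR) (mem_ball_zero_iff.mp (hmaps hR hFt)),
      hM.projAct_comp hR (mem_ball_zero_iff.mp (hmaps hR hFt)), hRinv _ hFt] at hst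
    rw [hMφ, coe_toBall hFt, ← hRinv _ hFs, hst, hRinv _ (hmaps hM hFt)]
  have key' : toBall (F c s) = φ • toBall (F c t) := by rw [key, toBall_coe]
  have hproj : BallQuotient.proj Γ hΓ (φ • toBall (F c t)) =
      BallQuotient.proj Γ hΓ (toBall (F c t)) :=
    (BallQuotient.isQuotientCoveringMap_proj Γ hΓ).map_smul (⟨φ, hφΓ⟩ : Γ)
  have hst' : s = t := hFinj c hc hs ht (by
    simp only [Function.comp_apply, BallQuotient.projExt]
    rw [key', hproj])
  rw [hst'] at key'
  exact hφ.smul_ne _ key'.symm
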